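/- Let $T>0$, let $J\subseteq\mathbb R$ be an interval (for instance $J=\mathbb R$, or a compact interval), and let $D_J=\{(s,t): 0\le s\le T,\ [t-s,t+s]\subseteq J\}$, so that $D_{\mathbb R}=[0,T]\times\mathbb R$. For $D\subseteq\mathbb R^2$ and $a,b\in(0,1)$ let $\mathcal C^{a,b}(D)$ be the set of functions $f$ that are continuous on $D$ and satisfy $$\sup\frac{|f(s_2,t_2)-f(s_2,t_1)-f(s_1,t_2)+f(s_1,t_1)|}{(s_2-s_1)^a(t_2-t_1)^b}<\infty,$$ the supremum being over all rectangles $[s_1,s_2]\times[t_1,t_2]\subseteq D$ with $s_1<s_2$, $t_1<t_2$. Let $\gamma,\hat\gamma\in(0,1)$ with $\gamma+\hat\gamma>\frac53$, let $\rho\in\left(\frac{3-2\gamma-\hat\gamma}{\hat\gamma},\frac{2\hat\gamma+\gamma-2}{\hat\gamma}\right)$, and set $\eta=\rho\hat\gamma+\gamma-1$, $\hat\eta=(1-\rho)\hat\gamma$. Let $X\in\mathcal C^{\gamma,\hat\gamma}([0,T]\times J)$ and $Z\in\mathcal C^{\eta,\hat\eta}([0,T]\times J)$. Suppose that $Z$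 satisfies the following hypothesis $(H_\alpha)$ for every $\alpha\in(2(2-\gamma-\hat\gamma),1)$: $Z$ is bounded on $[0,T]\times J$, $Z(0,t)=0$ for all $t\in J$, and there is a constant $C$ with $|Z(s_1,t)-Z(s_2,t)|\le C|s_1-s_2|^\alpha$ for all $s_1,s_2\in[0,T]$, $t\in J$. Let $G_r(t,v)=\frac12\mathbf 1_{\{|t-v|<r\}}$. Then for every $(s,t)\in D_J$ the integral $$\mathcal I_Z(s,t)=\int_0^s\int_{\mathbb R}G_{s-u}(t,v)\,Z(u,v)\,X(du,dv)$$ is well defined in the Young sense, that is, as the limit as $n\to\infty$ of the dyadic Riemann sums $$\sum_{i=0}^{2^n-1}\sum_{j=0}^{2^{n+1}-1}G_{s-u_i}(t,v_j)\,Z(u_i,v_j)\,\bigl[X(u_{i+1},v_{j+1})-X(u_{i+1},v_j)-X(u_i,v_{j+1})+X(u_i,v_j)\bigr],$$ with $u_i=s\,i2^{-n}$ and $v_j=t-s+s\,j2^{-n}$. Moreover the function $\mathcal I_Z$ belongs to $\mathcal C^{\eta,\hat\eta}(D_J)$. In particular, for $J=\mathbb R$, $\mathcal I_Z\in\mathcal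 C^{\eta,\hat\eta}([0,T]\times\mathbb R)$. -/

import Mathlib

open Filter Topology

noncomputable section

namespace YoungWave

/-- Rectangular increment `g(s,t) - g(s,t') - g(s',t) + g(s',t')` of `g` on `[s,s'] × [t,t']`. -/
def rectIncr (g : ℝ × ℝ → ℝ) (s s' t t' : ℝ) : ℝ :=
  g (s, t) - g (s, t') - g (s', t) + g (s', t')

/-- The class `C^{a,b}(D)`: functions continuous on `D` whose rectangular increments over the
nondegenerate rectangles `[s,s'] × [t,t'] ⊆ D` are bounded by a constant times
`(s'-s)^a (t'-t)^b`, that is, whose seminorm `‖f‖_{a,b}` on `D` is finite. -/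
def RectHolder (D : Set (ℝ × ℝ)) (a b : ℝ) (f : ℝ × ℝ → ℝ) : Prop :=
  ContinuousOn f D ∧
    ∃ K : ℝ, ∀ s s' t t' : ℝ, s < s' → t < t' → Set.Icc s s' ×ˢ Set.Icc t t' ⊆ D →
      |rectIncr f s s' t t'| ≤ K * (s' - s) ^ a * (t' - t) ^ b

/-- Hypothesis `(H_α)` on `[0,T] × J`: boundedness, vanishing at time `0`, and `α`-Hölder
continuity in time, uniformly in space. -/
def HypH (T : ℝ) (J : Set ℝ) (α : ℝ) (Z : ℝ × ℝ → ℝ) : Prop :=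
  (∃ M : ℝ, ∀ s ∈ Set.Icc 0 T, ∀ t ∈ J, |Z (s, t)| ≤ M) ∧
  (∀ t ∈ J, Z (0, t) = 0) ∧
  (∃ K : ℝ, ∀ s₁ ∈ Set.Icc 0 T, ∀ s₂ ∈ Set.Icc 0 T, ∀ t ∈ J,
    |Z (s₁, t) - Z (s₂, t)| ≤ K * |s₁ - s₂| ^ α)

/-- Fundamental solution of the one-dimensional wave equation, `G_r(t,v) = ½ 1_{|t-v| < r}`. -/
def waveKernel (r t v : ℝ) : ℝ := if |t - v| < r then 1 / 2 else 0

/-- The kernel `G_{s,t}(u,v) = G_{s-u}(t,v) 1_{[0,s]}(u)`. -/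
def coneKernel (s t u v : ℝ) : ℝ :=
  Set.indicator (Set.Icc 0 s) (fun u' => waveKernel (s - u') t v) u

/-- Time nodes `s i / 2^n` of the dyadic grid on `[0,s] × [t-s,t+s]`. -/
def timeNode (s : ℝ) (n i : ℕ) : ℝ := s * ((i : ℝ) / 2 ^ n)

/-- Space nodes `t - s + s j / 2^n` of the dyadic grid on `[0,s] × [t-s,t+s]`. -/
def spaceNode (s t : ℝ) (n j : ℕ) : ℝ := t - s + s * ((j : ℝ) / 2 ^ n)

/-- The `n`-th dyadic Riemann sum for `∫_0^s ∫ G_{s-u}(t,v) Z(u,v) X(du,dv)`. -/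
def riemannSum (X Z : ℝ × ℝ → ℝ) (s t : ℝ) (n : ℕ) : ℝ :=
  ∑ i ∈ Finset.range (2 ^ n), ∑ j ∈ Finset.range (2 ^ (n + 1)),
    coneKernel s t (timeNode s n i) (spaceNode s t n j) *
      Z (timeNode s n i, spaceNode s t n j) *
      rectIncr X (timeNode s n i) (timeNode s n (i + 1))
        (spaceNode s t n j) (spaceNode s t n (j + 1))

/-- `y` is the Young integral `∫_0^s ∫ G_{s-u}(t,v) Z(u,v) X(du,dv)`: the dyadic Riemann sums
converge to `y`. -/
def IsYoungIntegral (X Z : ℝ × ℝ → ℝ) (s t y : ℝ) : Prop :=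
  Tendsto (riemannSum X Z s t) atTop (𝓝 y)

/-- The points `(s,t)` of `[0,T] × ℝ` whose backward light cone, with base `[t-s,t+s]`, has its
base in `J`. For `J = ℝ` this is `[0,T] × ℝ`. -/
def coneDomain (T : ℝ) (J : Set ℝ) : Set (ℝ × ℝ) :=
  {p | p.1 ∈ Set.Icc 0 T ∧ Set.Icc (p.2 - p.1) (p.2 + p.1) ⊆ J}

end YoungWave

end

/-! Write □f for rectangular increments. Since `γ + η > 1` and `γ' + η' > 1`, `Z` can be integrated
against `X` over rectangles: sewing in space and then in time produces `W` whose increments □W play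
the role of ∫∫ Z dX, and □W differs from `Z(s,t)` □X by terms of total order `γ + γ' + η` and `γ +
γ' + η'` (`exists_rect_integral`).

The indicator of the cone is never treated as a Young integrand. The cone lies between two
characteristics, and its □W-mass is the difference of the line integrals of the time derivative of
`W` along them. These are again one-dimensional sewings, possible because `γ + γ' > 1`
(`exists_line_integral`).

Regularity: shifting a characteristic by `k` sweeps a strip made of about `1/k` pieces of mass `O(k
^ (γ + γ'))`, so the line integral moves by `O(k ^ (γ + γ' - 1))`. As `γ + γ' - 1 = η + η'`, the
cone integral is `(η + η')`-Hölder in `s` and in `t`, and min(δ,τ)^(η+η') ≤ δ^η τ^η' turns this into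
membership in C^{η,η'} (`rectHolder_of_holder`).

Convergence: with `N = 2 ^ n`, replacing `Z` □X by □W on each of the `O(N ^ 2)` cells costs in total
a multiple of N^(2-γ-γ'-η) + N^(2-γ-γ'-η'). The two bounds on `ρ` say exactly that these exponents
are negative. The sums of □W telescope along rows into staircases, which are Riemann sums of the two
line integrals. -/

namespace YoungWave

/-! ### The sewing lemma on subsets of the line. -/

/-- The germ `Ξ` has additivity defect at most `K * (z - x) ^ θ` on `I`. -/
def DefectBound (I : Set ℝ) (Ξ : ℝ → ℝ → ℝ) (K θ : ℝ) : Prop :=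
  ∀ x ∈ I, ∀ y ∈ I, ∀ z ∈ I, x ≤ y → y ≤ z → |Ξ x z - Ξ x y - Ξ y z| ≤ K * (z - x) ^ θ

/-- The increments of `w` agree with the germ `Ξ` up to `B * (y - x) ^ θ` on `I`. -/
def Approximates (I : Set ℝ) (w : ℝ → ℝ) (Ξ : ℝ → ℝ → ℝ) (B θ : ℝ) : Prop :=
  ∀ x ∈ I, ∀ y ∈ I, x ≤ y → |w y - w x - Ξ x y| ≤ B * (y - x) ^ θ

/-- The constant of the sewing lemma. -/
noncomputable def sewConst (θ : ℝ) : ℝ := 2 / (1 - 2 * (1 / 2 : ℝ) ^ θ)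

lemma two_mul_half_rpow_lt_one {θ : ℝ} (hθ : 1 < θ) : 2 * (1 / 2 : ℝ) ^ θ < 1 := by
  have := Real.rpow_lt_rpow_of_exponent_gt (x := (1 / 2 : ℝ)) (by norm_num) (by norm_num) hθ
  rw [Real.rpow_one] at this
  linarith

lemma sewConst_pos {θ : ℝ} (hθ : 1 < θ) : 0 < sewConst θ :=
  div_pos two_pos (by linarith [two_mul_half_rpow_lt_one hθ])

/-- Fixed point of the recursion in `sum_sub_germ_le`: two defects, plus two blocks of at most half
the length. -/
lemma sewConst_eq {θ : ℝ} (hθ : 1 < θ) :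
    2 + 2 * (1 / 2 : ℝ) ^ θ * sewConst θ = sewConst θ := by
  have h : 1 - 2 * (1 / 2 : ℝ) ^ θ ≠ 0 := by linarith [two_mul_half_rpow_lt_one hθ]
  unfold sewConst
  field_simp
  ring

lemma germ_self {I : Set ℝ} {Ξ : ℝ → ℝ → ℝ} {K θ : ℝ} (hθ : 1 < θ)
    (hΞ : DefectBound I Ξ K θ) {x : ℝ} (hx : x ∈ I) : Ξ x x = 0 := by
  have := hΞ x hx x hx x hx le_rfl le_rfl
  rw [sub_self x, Real.zero_rpow (by linarith), mul_zero] at this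
  have := abs_nonpos_iff.1 this
  linarith

/-- Young's estimate: Riemann sums of a germ with small defect stay close to the germ. -/
lemma sum_sub_germ_le {I : Set ℝ} {Ξ : ℝ → ℝ → ℝ} {K θ : ℝ} (hθ : 1 < θ) (hK : 0 ≤ K)
    (hΞ : DefectBound I Ξ K θ) {x : ℕ → ℝ} (hx : Monotone x) (hxI : ∀ n, x n ∈ I) (n : ℕ) :
    ∀ i, |∑ j ∈ Finset.range n, Ξ (x (i + j)) (x (i + j + 1)) - Ξ (x i) (x (i + n))|
      ≤ sewConst θ * K * (x (i + n) - x i) ^ θ := by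
  have hC := sewConst_pos hθ
  induction n using Nat.strong_induction_on with
  | _ n ih =>
    intro i
    rcases Nat.eq_zero_or_pos n with rfl | hn
    · simp [germ_self hθ hΞ (hxI i), Real.zero_rpow (by linarith : θ ≠ 0)]
    classical
    set h := x (i + n) - x i with hh
    have hh0 : 0 ≤ h := sub_nonneg.2 (hx (by omega))
    -- Isolate the last interval that starts in the left half. The blocks before and after it each
    -- span at most `h / 2`, so induction gains a factor (1/2)^θ on each, and joining the three
    -- pieces costs two defects.
    set P : ℕ → Prop := fun m => x (i + m) ≤ x i + h / 2 with hP
    obtain ⟨m, hm⟩ : ∃ m, m = Nat.findGreatest P (n - 1) := ⟨_, rfl⟩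
    have hmP : P m := by
      rw [hm]
      exact Nat.findGreatest_spec (P := P) (Nat.zero_le _) (by simp [hP]; positivity)
    have hmn : m ≤ n - 1 := hm ▸ Nat.findGreatest_le _
    have hright : x (i + n) - x (i + (m + 1)) ≤ h / 2 := by
      rcases Nat.lt_or_ge m (n - 1) with h1 | h1
      · have : ¬ P (m + 1) := by
          refine Nat.findGreatest_is_greatest (P := P) (n := n - 1) ?_ ?_ <;> omega
        simp only [hP, not_le] at this
        linarith
      · have : m + 1 = n := by omega
        rw [this, sub_self]; positivity
    obtain ⟨l, rfl⟩ : ∃ l, n = m + (1 + l) := ⟨n - m - 1, by omega⟩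
    have e1 := ih m (by omega) i
    have e2 := ih l (by omega) (i + (m + 1))
    have i1 : i + (m + 1) + l = i + (m + (1 + l)) := by ring
    rw [i1] at e2
    have b1 : (x (i + m) - x i) ^ θ ≤ (1 / 2 : ℝ) ^ θ * h ^ θ := by
      rw [← Real.mul_rpow (by norm_num) hh0]
      refine Real.rpow_le_rpow (sub_nonneg.2 (hx (by omega))) ?_ (by linarith)
      have : x (i + m) ≤ x i + h / 2 := hmP
      linarith
    have b2 : (x (i + (m + (1 + l))) - x (i + (m + 1))) ^ θ ≤ (1 / 2 : ℝ) ^ θ * h ^ θ := by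
      rw [← Real.mul_rpow (by norm_num) hh0]
      refine Real.rpow_le_rpow (sub_nonneg.2 (hx (by omega))) ?_ (by linarith)
      linarith
    have d1 := hΞ _ (hxI i) _ (hxI (i + m)) _ (hxI (i + (m + (1 + l)))) (hx (by omega))
      (hx (by omega))
    have d2 := hΞ _ (hxI (i + m)) _ (hxI (i + (m + 1))) _ (hxI (i + (m + (1 + l))))
      (hx (by omega)) (hx (by omega))
    have b3 : (x (i + (m + (1 + l))) - x (i + m)) ^ θ ≤ h ^ θ := by
      refine Real.rpow_le_rpow (sub_nonneg.2 (hx (by omega))) ?_ (by linarith)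
      have : x i ≤ x (i + m) := hx (by omega)
      linarith
    have d2' := d2.trans (mul_le_mul_of_nonneg_left b3 hK)
    have e1' := e1.trans (mul_le_mul_of_nonneg_left b1 (by positivity))
    have e2' := e2.trans (mul_le_mul_of_nonneg_left b2 (by positivity))
    have hsum : ∑ j ∈ Finset.range (m + (1 + l)), Ξ (x (i + j)) (x (i + j + 1))
        = ∑ j ∈ Finset.range m, Ξ (x (i + j)) (x (i + j + 1)) + Ξ (x (i + m)) (x (i + (m + 1)))
          + ∑ j ∈ Finset.range l, Ξ (x (i + (m + 1) + j)) (x (i + (m + 1) + j + 1)) := by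
      rw [Finset.sum_range_add, Finset.sum_range_add, Finset.sum_range_one, ← add_assoc]
      congr 1
      refine Finset.sum_congr rfl fun j _ => ?_
      congr 2 <;> ring
    rw [hsum]
    have hfin : sewConst θ * K * h ^ θ = K * h ^ θ + K * h ^ θ
        + sewConst θ * K * ((1 / 2 : ℝ) ^ θ * h ^ θ)
        + sewConst θ * K * ((1 / 2 : ℝ) ^ θ * h ^ θ) := by
      nth_rewrite 1 [← sewConst_eq hθ]; ring
    rw [hfin]
    rw [abs_le] at *
    constructor <;> linarith [d1.1, d1.2, d2'.1, d2'.2, e1'.1, e1'.2, e2'.1, e2'.2]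

/-- On a finite set, sums of the germ over consecutive points serve as a primitive, by
`sum_sub_germ_le`. -/
lemma exists_approximates_finset {I : Set ℝ} {Ξ : ℝ → ℝ → ℝ} {K θ : ℝ} (hθ : 1 < θ) (hK : 0 ≤ K)
    (hΞ : DefectBound I Ξ K θ) (π : Finset ℝ) (hπ : ∀ x ∈ π, x ∈ I) :
    ∃ w : ℝ → ℝ, Approximates π w Ξ (sewConst θ * K) θ := by
  classical
  rcases π.eq_empty_or_nonempty with rfl | hne
  · exact ⟨0, by simp [Approximates]⟩
  have hc : 0 < π.card := hne.card_pos
  -- Increasing enumeration of `π`, frozen at its last point so as to be monotone on all of `ℕ`.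
  let x : ℕ → ℝ := fun k => π.orderEmbOfFin rfl ⟨min k (π.card - 1), by omega⟩
  have hx : Monotone x := fun k l hkl =>
    (π.orderEmbOfFin rfl).monotone (by simp only [Fin.mk_le_mk]; omega)
  have hsurj : ∀ y ∈ π, ∃ k, x k = y := by
    intro y hy
    have : y ∈ Set.range (π.orderEmbOfFin rfl) := by rw [Finset.range_orderEmbOfFin]; exact hy
    obtain ⟨k, rfl⟩ := this
    refine ⟨k, ?_⟩
    simp only [x]
    congr 1
    ext
    have := k.2
    simp only; omega
  choose! idx hidx using hsurj
  refine ⟨fun y => ∑ j ∈ Finset.range (idx y), Ξ (x j) (x (j + 1)), fun p hp q hq hpq => ?_⟩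
  have hp' := hidx p hp
  have hq' := hidx q hq
  have hle : idx p ≤ idx q := by
    by_contra hlt
    have h1 : q ≤ p := by rw [← hp', ← hq']; exact hx (by omega)
    have : p = q := le_antisymm hpq h1
    subst this
    exact hlt le_rfl
  obtain ⟨n, hn⟩ := Nat.exists_eq_add_of_le hle
  have := sum_sub_germ_le hθ hK hΞ hx
    (fun n => hπ _ (Finset.orderEmbOfFin_mem π rfl _)) n (idx p)
  rw [← hn, hp', hq'] at this
  simp only [hn, Finset.sum_range_add]
  rw [add_sub_cancel_left]
  exact this

/-- The sewing lemma. -/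
lemma sewing {I : Set ℝ} {Ξ : ℝ → ℝ → ℝ} {K θ : ℝ} (hθ : 1 < θ) (hK : 0 ≤ K)
    (hΞ : DefectBound I Ξ K θ) : ∃ w : ℝ → ℝ, Approximates I w Ξ (sewConst θ * K) θ := by
  classical
  rcases I.eq_empty_or_nonempty with rfl | ⟨x₀, hx₀⟩
  · exact ⟨0, by simp [Approximates]⟩
  have key : ∀ π : Finset I, ∃ w : ℝ → ℝ,
      Approximates (π.map (Function.Embedding.subtype _) : Finset ℝ) w Ξ (sewConst θ * K) θ :=
    fun π => exists_approximates_finset hθ hK hΞ _ (by simp +contextual)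
  choose w hw using key
  -- Compactness replaces convergence under refinement: the primitives on finite subsets, normalised
  -- at `x₀`, stay bounded at each point and so have a limit along an ultrafilter.
  let U : Ultrafilter (Finset I) := Ultrafilter.of atTop
  have hU : (U : Filter (Finset I)) ≤ atTop := Ultrafilter.of_le _
  have hmem : ∀ x (hx : x ∈ I), ∀ᶠ π : Finset I in U,
      x ∈ (π.map (Function.Embedding.subtype _) : Finset ℝ) := fun x hx => by
    refine hU ((eventually_ge_atTop {⟨x, hx⟩}).mono fun π hπ => ?_)
    simpa [hx] using hπ
  have hlim : ∀ x ∈ I, ∃ l, Tendsto (fun π => w π x - w π x₀) U (𝓝 l) := by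
    intro x hx
    obtain ⟨B, hB⟩ : ∃ B, ∀ᶠ π : Finset I in U, w π x - w π x₀ ∈ Set.Icc (-B) B := by
      rcases le_total x₀ x with h | h
      · refine ⟨|Ξ x₀ x| + sewConst θ * K * (x - x₀) ^ θ, ?_⟩
        filter_upwards [hmem x hx, hmem x₀ hx₀] with π h1 h2
        rw [Set.mem_Icc, ← abs_le]
        linarith [hw π x₀ h2 x h1 h, abs_sub_abs_le_abs_sub (w π x - w π x₀) (Ξ x₀ x)]
      · refine ⟨|Ξ x x₀| + sewConst θ * K * (x₀ - x) ^ θ, ?_⟩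
        filter_upwards [hmem x hx, hmem x₀ hx₀] with π h1 h2
        rw [Set.mem_Icc, ← abs_le, abs_sub_comm]
        linarith [hw π x h1 x₀ h2 h, abs_sub_abs_le_abs_sub (w π x₀ - w π x) (Ξ x x₀)]
    obtain ⟨l, -, hl⟩ := (isCompact_Icc (a := -B) (b := B)).ultrafilter_le_nhds
      (U.map fun π => w π x - w π x₀) (le_principal_iff.2 hB)
    exact ⟨l, hl⟩
  choose! W hW using hlim
  refine ⟨W, fun x hx y hy hxy => ?_⟩
  have ht : Tendsto (fun π => |w π y - w π x - Ξ x y|) U (𝓝 |W y - W x - Ξ x y|) := by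
    have := (((hW y hy).sub (hW x hx)).sub_const (Ξ x y)).abs
    simpa using this
  refine le_of_tendsto ht ?_
  filter_upwards [hmem x hx, hmem y hy] with π h1 h2
  exact hw π x h1 y h2 hxy

/-- Riemann sums along the uniform partition of `[x, y]` into `n` pieces. -/
lemma abs_sub_uniform_sum_le {I : Set ℝ} (hI : I.OrdConnected) {w : ℝ → ℝ} {Ξ : ℝ → ℝ → ℝ}
    {B θ : ℝ} (h : Approximates I w Ξ B θ) {x y : ℝ} (hx : x ∈ I) (hy : y ∈ I) (hxy : x ≤ y)
    {n : ℕ} (hn : 0 < n) :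
    |w y - w x - ∑ i ∈ Finset.range n,
      Ξ (x + (y - x) * (i / n)) (x + (y - x) * ((i + 1 : ℕ) / n))| ≤
      n * (B * ((y - x) / n) ^ θ) := by
  have hn' : (0 : ℝ) < n := by exact_mod_cast hn
  have hd : 0 ≤ y - x := sub_nonneg.2 hxy
  set p : ℕ → ℝ := fun i => x + (y - x) * (i / n) with hp
  have hpI : ∀ i ≤ n, p i ∈ I := fun i hi => by
    have h1 : (i : ℝ) / n ≤ 1 := (div_le_one hn').2 (by exact_mod_cast hi)
    have h0 : 0 ≤ (i : ℝ) / n := by positivity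
    exact hI.out hx hy ⟨by simp only [hp]; nlinarith, by simp only [hp]; nlinarith⟩
  have h0 : p 0 = x := by simp [hp]
  have h1 : p n = y := by simp [hp, hn'.ne']
  have htel : w y - w x = ∑ i ∈ Finset.range n, (w (p (i + 1)) - w (p i)) := by
    rw [Finset.sum_range_sub (fun i => w (p i)), h0, h1]
  rw [htel, ← Finset.sum_sub_distrib]
  refine (Finset.abs_sum_le_sum_abs _ _).trans ?_
  refine (Finset.sum_le_card_nsmul _ _ (B * ((y - x) / n) ^ θ) fun i hi => ?_).trans_eq
    (by simp)
  have hi' := Finset.mem_range.1 hi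
  have hs : p (i + 1) - p i = (y - x) / n := by
    simp only [hp]; push_cast; field_simp; ring
  have := h (p i) (hpI i (by omega)) (p (i + 1)) (hpI (i + 1) (by omega))
    (by rw [← sub_nonneg, hs]; positivity)
  rwa [hs] at this

lemma mul_div_rpow_eq {d θ : ℝ} (hd : 0 ≤ d) {n : ℕ} (hn : 0 < n) (B : ℝ) :
    (n : ℝ) * (B * (d / n) ^ θ) = B * d ^ θ * (n : ℝ) ^ (-(θ - 1)) := by
  have hn' : (0 : ℝ) < n := by exact_mod_cast hn
  rw [Real.div_rpow hd hn'.le, neg_sub, Real.rpow_sub hn', Real.rpow_one]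
  field_simp

lemma tendsto_natCast_rpow_neg {κ : ℝ} (hκ : 0 < κ) (B : ℝ) :
    Tendsto (fun n : ℕ => B * (n : ℝ) ^ (-κ)) atTop (𝓝 0) := by
  have := ((tendsto_rpow_neg_atTop hκ).comp tendsto_natCast_atTop_atTop).const_mul B
  simpa using this

/-- A primitive of a germ with small defect satisfies the bound of the sewing lemma as soon as it
satisfies it with some constant. -/
lemma Approximates.sharp {I : Set ℝ} (hI : I.OrdConnected) {w : ℝ → ℝ} {Ξ : ℝ → ℝ → ℝ}
    {B K θ : ℝ} (hθ : 1 < θ) (hK : 0 ≤ K) (hΞ : DefectBound I Ξ K θ)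
    (hw : Approximates I w Ξ B θ) : Approximates I w Ξ (sewConst θ * K) θ := by
  -- Uniqueness: two primitives of one germ differ by a function with increments `O((y - x) ^ θ)`,
  -- `θ > 1`, hence by a constant.
  obtain ⟨v, hv⟩ := sewing hθ hK hΞ
  have hd : Approximates I (fun x => w x - v x) (fun _ _ => 0) (B + sewConst θ * K) θ := by
    intro x hx y hy hxy
    have h1 := hw x hx y hy hxy
    have h2 := hv x hx y hy hxy
    rw [add_mul, sub_zero]
    rw [abs_le] at *
    constructor <;> linarith [h1.1, h1.2, h2.1, h2.2]
  intro x hx y hy hxy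
  have hz : |(w y - v y) - (w x - v x)| ≤ 0 := by
    refine ge_of_tendsto (tendsto_natCast_rpow_neg (sub_pos.2 hθ)
      ((B + sewConst θ * K) * (y - x) ^ θ)) ?_
    filter_upwards [eventually_gt_atTop 0] with n hn
    have := abs_sub_uniform_sum_le hI hd hx hy hxy hn
    rw [mul_div_rpow_eq (sub_nonneg.2 hxy) hn] at this
    simpa using this
  have hz' := abs_nonpos_iff.1 hz
  have : w y - w x = v y - v x := by linarith
  rw [this]
  exact hv x hx y hy hxy

/-! ### The two-parameter Young integral over rectangles. -/

/-- Rectangular increments over the rectangles of `[0, T] × J`, degenerate ones included, are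
bounded by `A * (s' - s) ^ a * (t' - t) ^ b`. -/
def RectBound (T : ℝ) (J : Set ℝ) (a b A : ℝ) (f : ℝ × ℝ → ℝ) : Prop :=
  ∀ s ∈ Set.Icc 0 T, ∀ s' ∈ Set.Icc 0 T, s ≤ s' → ∀ t ∈ J, ∀ t' ∈ J, t ≤ t' →
    |rectIncr f s s' t t'| ≤ A * (s' - s) ^ a * (t' - t) ^ b

lemma RectHolder.exists_rectBound {T : ℝ} {J : Set ℝ} (hJ : J.OrdConnected) {a b : ℝ}
    {f : ℝ × ℝ → ℝ} (h : RectHolder (Set.Icc 0 T ×ˢ J) a b f) :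
    ∃ A, 0 ≤ A ∧ RectBound T J a b A f := by
  obtain ⟨-, K, hK⟩ := h
  refine ⟨|K|, abs_nonneg _, fun s hs s' hs' hss t ht t' ht' htt => ?_⟩
  have h1 : 0 ≤ (s' - s) ^ a := Real.rpow_nonneg (sub_nonneg.2 hss) _
  have h2 : 0 ≤ (t' - t) ^ b := Real.rpow_nonneg (sub_nonneg.2 htt) _
  rcases hss.eq_or_lt with rfl | hss
  · have : rectIncr f s s t t' = 0 := by unfold rectIncr; ring
    rw [this, abs_zero]; positivity
  rcases htt.eq_or_lt with rfl | htt
  · have : rectIncr f s s' t t = 0 := by unfold rectIncr; ring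
    rw [this, abs_zero]; positivity
  refine (hK s s' t t' hss htt
    (Set.prod_mono (Set.Icc_subset_Icc hs.1 hs'.2) (hJ.out ht ht'))).trans ?_
  gcongr
  exact le_abs_self K

lemma rpow_mul_rpow_le {x y z p q : ℝ} (hx : 0 ≤ x) (hy : 0 ≤ y) (hxz : x ≤ z) (hyz : y ≤ z)
    (hp : 0 ≤ p) (hq : 0 ≤ q) : x ^ p * y ^ q ≤ z ^ (p + q) := by
  rw [Real.rpow_add_of_nonneg (hx.trans hxz) hp hq]
  exact mul_le_mul (Real.rpow_le_rpow hx hxz hp) (Real.rpow_le_rpow hy hyz hq)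
    (Real.rpow_nonneg hy _) (Real.rpow_nonneg (hx.trans hxz) _)

/-- The defect of the germ `f x * G x y` of a Young integral. -/
lemma defectBound_young {J : Set ℝ} {f : ℝ → ℝ} {G : ℝ → ℝ → ℝ} {F A p q : ℝ}
    (hp : 0 ≤ p) (hq : 0 ≤ q) (hF : 0 ≤ F) (hA : 0 ≤ A)
    (hf : ∀ x ∈ J, ∀ y ∈ J, x ≤ y → |f y - f x| ≤ F * (y - x) ^ p)
    (hG : ∀ x ∈ J, ∀ y ∈ J, x ≤ y → |G x y| ≤ A * (y - x) ^ q)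
    (hadd : ∀ x y z, G x z = G x y + G y z) :
    DefectBound J (fun x y => f x * G x y) (F * A) (p + q) := by
  intro x hx y hy z hz hxy hyz
  have e : f x * G x z - f x * G x y - f y * G y z = -((f y - f x) * G y z) := by
    rw [hadd x y z]; ring
  rw [e, abs_neg, abs_mul]
  calc |f y - f x| * |G y z| ≤ (F * (y - x) ^ p) * (A * (z - y) ^ q) :=
        mul_le_mul (hf x hx y hy hxy) (hG y hy z hz hyz) (abs_nonneg _)
          (mul_nonneg hF (Real.rpow_nonneg (sub_nonneg.2 hxy) _))
    _ = F * A * ((y - x) ^ p * (z - y) ^ q) := by ring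
    _ ≤ F * A * (z - x) ^ (p + q) := by
        refine mul_le_mul_of_nonneg_left ?_ (by positivity)
        exact rpow_mul_rpow_le (by linarith) (by linarith) (by linarith) (by linarith) hp hq

lemma Approximates.sub {I : Set ℝ} {w₁ w₂ : ℝ → ℝ} {Ξ₁ Ξ₂ : ℝ → ℝ → ℝ} {B₁ B₂ θ : ℝ}
    (h₁ : Approximates I w₁ Ξ₁ B₁ θ) (h₂ : Approximates I w₂ Ξ₂ B₂ θ) :
    Approximates I (fun x => w₁ x - w₂ x) (fun x y => Ξ₁ x y - Ξ₂ x y) (B₁ + B₂) θ := by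
  intro x hx y hy hxy
  have h1 := h₁ x hx y hy hxy
  have h2 := h₂ x hx y hy hxy
  rw [add_mul]
  rw [abs_le] at *
  constructor <;> linarith [h1.1, h1.2, h2.1, h2.2]

/-- Young integrals in space, `V u r v = ∫^v Z(u, y) d(X(r, y) - X(0, y))`. -/
lemma exists_space_integral {T : ℝ} (hT : 0 ≤ T) {J : Set ℝ} (hJ : J.OrdConnected)
    {a b η η' A B : ℝ} (hb : 0 ≤ b) (hη' : 0 ≤ η') (hbη : 1 < η' + b)
    (hA : 0 ≤ A) (hB : 0 ≤ B) {X Z : ℝ × ℝ → ℝ} (hX : RectBound T J a b A X)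
    (hZ : RectBound T J η η' B Z) :
    ∃ V : ℝ → ℝ → ℝ → ℝ, (∀ r v, V 0 r v = 0) ∧
      ∀ m ∈ Set.Icc 0 T, ∀ u ∈ Set.Icc 0 T, m ≤ u →
      ∀ r ∈ Set.Icc 0 T, ∀ r' ∈ Set.Icc 0 T, r ≤ r' →
        Approximates J (fun v => V u r' v - V u r v - (V m r' v - V m r v))
          (fun x y => (Z (u, x) - Z (m, x)) * rectIncr X r r' x y)
          (sewConst (η' + b) * (B * (u - m) ^ η * (A * (r' - r) ^ a))) (η' + b) := by
  have hdef : ∀ m ∈ Set.Icc 0 T, ∀ u ∈ Set.Icc 0 T, m ≤ u →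
      ∀ r ∈ Set.Icc 0 T, ∀ r' ∈ Set.Icc 0 T, r ≤ r' →
      DefectBound J (fun x y => (Z (u, x) - Z (m, x)) * rectIncr X r r' x y)
        (B * (u - m) ^ η * (A * (r' - r) ^ a)) (η' + b) := by
    intro m hm u hu hmu r hr r' hr' hrr
    have h1 := Real.rpow_nonneg (sub_nonneg.2 hmu) η
    have h2 := Real.rpow_nonneg (sub_nonneg.2 hrr) a
    refine defectBound_young (f := fun x => Z (u, x) - Z (m, x)) hη' hb (by positivity)
      (by positivity) (fun x hx y hy hxy => ?_) (fun x hx y hy hxy => ?_) (fun x y z => ?_)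
    · have := hZ m hm u hu hmu x hx y hy hxy
      have e : Z (u, y) - Z (m, y) - (Z (u, x) - Z (m, x)) = rectIncr Z m u x y := by
        unfold rectIncr; ring
      rw [e]; exact this
    · exact hX r hr r' hr' hrr x hx y hy hxy
    · unfold rectIncr; ring
  have h00 : (0 : ℝ) ∈ Set.Icc 0 T := ⟨le_rfl, hT⟩
  have hex : ∀ u, ∀ r, ∃ w : ℝ → ℝ, u ∈ Set.Icc 0 T → r ∈ Set.Icc 0 T →
      Approximates J w (fun x y => (Z (u, x) - Z (0, x)) * rectIncr X 0 r x y)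
        (sewConst (η' + b) * (B * (u - 0) ^ η * (A * (r - 0) ^ a))) (η' + b) := by
    intro u r
    by_cases hu : u ∈ Set.Icc 0 T
    · by_cases hr : r ∈ Set.Icc 0 T
      · have h1 := Real.rpow_nonneg (sub_nonneg.2 hu.1) η
        have h2 := Real.rpow_nonneg (sub_nonneg.2 hr.1) a
        obtain ⟨w, hw⟩ := sewing hbη (by positivity) (hdef 0 h00 u hu hu.1 0 h00 r hr hr.1)
        exact ⟨w, fun _ _ => hw⟩
      · exact ⟨0, fun _ h => absurd h hr⟩
    · exact ⟨0, fun h => absurd h hu⟩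
  choose V hV using hex
  -- Subtracting `V 0` makes the family vanish at `u = 0` and cancels in differences between `u` and
  -- `m`.
  refine ⟨fun u r v => V u r v - V 0 r v, fun r v => sub_self _, ?_⟩
  intro m hm u hu hmu r hr r' hr' hrr
  have h1 := Real.rpow_nonneg (sub_nonneg.2 hmu) η
  have h2 := Real.rpow_nonneg (sub_nonneg.2 hrr) a
  have happ := ((hV u r' hu hr').sub (hV u r hu hr)).sub ((hV m r' hm hr').sub (hV m r hm hr))
  have e : (fun x y => ((Z (u, x) - Z (0, x)) * rectIncr X 0 r' x y
      - (Z (u, x) - Z (0, x)) * rectIncr X 0 r x y)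
      - ((Z (m, x) - Z (0, x)) * rectIncr X 0 r' x y
      - (Z (m, x) - Z (0, x)) * rectIncr X 0 r x y))
      = fun x y => (Z (u, x) - Z (m, x)) * rectIncr X r r' x y := by
    funext x y; unfold rectIncr; ring
  rw [e] at happ
  -- The four primitives were sewn independently, so the constant in `happ` does not shrink with `u
  -- - m` or `r' - r`; uniqueness replaces it by the right one.
  have := happ.sharp hJ hbη (by positivity) (hdef m hm u hu hmu r hr r' hr' hrr)
  convert this using 2
  ring

/-- The two-parameter Young integral of `Z` against `X`, as a function `W` whose rectangular
increments are the integrals over rectangles. -/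
lemma exists_rect_integral {T : ℝ} (hT : 0 ≤ T) {J : Set ℝ} (hJ : J.OrdConnected)
    {a b η η' A B B' : ℝ} (ha : 0 ≤ a) (hb : 0 ≤ b) (hη : 0 ≤ η) (hη' : 0 ≤ η')
    (haη : 1 < η + a) (hbη : 1 < η' + b) (hA : 0 ≤ A) (hB : 0 ≤ B) (hB' : 0 ≤ B')
    {X Z : ℝ × ℝ → ℝ} (hX : RectBound T J a b A X)
    (hZ : RectBound T J η η' B Z) (hZ0 : ∀ t ∈ J, Z (0, t) = 0)
    (hZt : ∀ s ∈ Set.Icc 0 T, ∀ s' ∈ Set.Icc 0 T, s ≤ s' → ∀ t ∈ J,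
      |Z (s', t) - Z (s, t)| ≤ B' * (s' - s) ^ η) :
    ∃ (W : ℝ × ℝ → ℝ) (C₁ C₂ C₃ : ℝ), 0 ≤ C₁ ∧ 0 ≤ C₂ ∧ 0 ≤ C₃ ∧
      ∀ s ∈ Set.Icc 0 T, ∀ s' ∈ Set.Icc 0 T, s ≤ s' → ∀ t ∈ J, ∀ t' ∈ J, t ≤ t' →
        |rectIncr W s s' t t' - Z (s, t) * rectIncr X s s' t t'| ≤
          (C₁ * (t' - t) ^ b + C₂ * (t' - t) ^ (η' + b)) * (s' - s) ^ (η + a)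
            + C₃ * (s' - s) ^ a * (t' - t) ^ (η' + b) := by
  rcases J.eq_empty_or_nonempty with rfl | ⟨v₀, hv₀⟩
  · exact ⟨0, 0, 0, 0, le_rfl, le_rfl, le_rfl, by simp⟩
  obtain ⟨V, hV0, hV⟩ := exists_space_integral hT hJ hb hη' hbη hA hB hX hZ
  set c := sewConst (η' + b) with hc
  have hc0 : 0 < c := sewConst_pos hbη
  have hc1 : 0 < sewConst (η + a) := sewConst_pos haη
  -- Time germ: the integral up to `v` of `Z(x,·)`, frozen at the left time `x`, against `X(y,·) -
  -- X(x,·)`.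
  let G : ℝ → ℝ → ℝ → ℝ := fun v x y => V x y v - V x x v
  let D : ℝ → ℝ := fun k => B' * A * k ^ b + c * B * A * k ^ (η' + b)
  have hD : ∀ k, 0 ≤ k → 0 ≤ D k := fun k hk => by
    have h1 := Real.rpow_nonneg hk b
    have h2 := Real.rpow_nonneg hk (η' + b)
    simp only [D]; positivity
  have hdef : ∀ v ∈ J, ∀ v' ∈ J, v ≤ v' →
      DefectBound (Set.Icc 0 T) (fun x y => G v' x y - G v x y) (D (v' - v)) (η + a) := by
    intro v hv v' hv' hvv x hx y hy z hz hxy hyz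
    have hk1 := Real.rpow_nonneg (sub_nonneg.2 hvv) b
    have hk2 := Real.rpow_nonneg (sub_nonneg.2 hvv) (η' + b)
    -- The time defect of `G` is minus a mixed difference of `V`, from `x` to `y` in the integrand
    -- and from `y` to `z` in the integrator.
    have h1 := hV x hx y hy hxy y hy z hz hyz v hv v' hv' hvv
    have h2 : |(Z (y, v) - Z (x, v)) * rectIncr X y z v v'|
        ≤ B' * (y - x) ^ η * (A * (z - y) ^ a * (v' - v) ^ b) := by
      rw [abs_mul]
      exact mul_le_mul (hZt x hx y hy hxy v hv) (hX y hy z hz hyz v hv v' hv' hvv) (abs_nonneg _)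
        (mul_nonneg hB' (Real.rpow_nonneg (sub_nonneg.2 hxy) _))
    have h3 : (y - x) ^ η * (z - y) ^ a ≤ (z - x) ^ (η + a) :=
      rpow_mul_rpow_le (by linarith) (by linarith) (by linarith) (by linarith) hη ha
    have h4 : B' * (y - x) ^ η * (A * (z - y) ^ a * (v' - v) ^ b)
        + c * (B * (y - x) ^ η * (A * (z - y) ^ a)) * (v' - v) ^ (η' + b)
        ≤ D (v' - v) * (z - x) ^ (η + a) := by
      refine le_trans (le_of_eq ?_) (mul_le_mul_of_nonneg_left h3 (hD _ (sub_nonneg.2 hvv)))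
      simp only [D]; ring
    refine le_trans ?_ h4
    simp only [G]
    rw [abs_le] at *
    constructor <;> linarith [h1.1, h1.2, h2.1, h2.2]
  have hex : ∀ v ∈ J, ∃ w : ℝ → ℝ, ∃ K, Approximates (Set.Icc 0 T) w
      (fun x y => G v x y - G v₀ x y) K (η + a) := by
    intro v hv
    rcases le_total v₀ v with h | h
    · obtain ⟨w, hw⟩ := sewing haη (hD _ (sub_nonneg.2 h)) (hdef v₀ hv₀ v hv h)
      exact ⟨w, _, hw⟩
    · obtain ⟨w, hw⟩ := sewing haη (hD _ (sub_nonneg.2 h)) (hdef v hv v₀ hv₀ h)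
      refine ⟨fun x => - w x, _, fun x hx y hy hxy => (le_of_eq ?_).trans (hw x hx y hy hxy)⟩
      rw [← abs_neg]; congr 1; ring
  choose! w K hw using hex
  refine ⟨fun p => w p.2 p.1, sewConst (η + a) * (B' * A), sewConst (η + a) * (c * B * A),
    c * B * A * T ^ η, by positivity, by positivity, by positivity, ?_⟩
  intro s hs s' hs' hss t ht t' ht' htt
  have happ := (hw t' ht').sub (hw t ht)
  simp only [sub_sub_sub_cancel_right] at happ
  -- `w t` and `w t'` were each sewn relative to `v₀`; uniqueness yields a bound in terms of `t' -
  -- t` alone.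
  have h1 := happ.sharp Set.ordConnected_Icc haη (hD _ (sub_nonneg.2 htt))
    (hdef t ht t' ht' htt) s hs s' hs' hss
  -- Comparing with time `0`, where both `V` and `Z` vanish, gives the estimate for `Z(s,·)` itself.
  have h2 := hV 0 ⟨le_rfl, hT⟩ s hs hs.1 s hs s' hs' hss t ht t' ht' htt
  simp only [hV0, hZ0 t ht, sub_zero] at h2
  have hk1 := Real.rpow_nonneg (sub_nonneg.2 hss) a
  have hk2 := Real.rpow_nonneg (sub_nonneg.2 htt) (η' + b)
  have h3 : c * (B * s ^ η * (A * (s' - s) ^ a)) * (t' - t) ^ (η' + b)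
      ≤ c * B * A * T ^ η * (s' - s) ^ a * (t' - t) ^ (η' + b) := by
    have : s ^ η ≤ T ^ η := Real.rpow_le_rpow hs.1 hs.2 hη
    calc _ = c * B * A * s ^ η * (s' - s) ^ a * (t' - t) ^ (η' + b) := by ring
      _ ≤ _ := by gcongr
  have h4 := h2.trans h3
  have h5 : sewConst (η + a) * D (t' - t) * (s' - s) ^ (η + a)
      = (sewConst (η + a) * (B' * A) * (t' - t) ^ b
        + sewConst (η + a) * (c * B * A) * (t' - t) ^ (η' + b)) * (s' - s) ^ (η + a) := by
    simp only [D]; ring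
  rw [h5] at h1
  simp only [G] at h1
  unfold rectIncr at *
  simp only
  rw [abs_le] at *
  constructor <;> linarith [h1.1, h1.2, h4.1, h4.2]

/-! ### Line integrals along characteristics. -/

/-- `RectBound` restricted to rectangles whose space side is at most `T`. -/
def LocalRectBound (T : ℝ) (J : Set ℝ) (a b C : ℝ) (W : ℝ × ℝ → ℝ) : Prop :=
  ∀ r ∈ Set.Icc 0 T, ∀ s ∈ Set.Icc 0 T, r ≤ s → ∀ u ∈ J, ∀ v ∈ J, u ≤ v → v - u ≤ T →
    |rectIncr W r s u v| ≤ C * (s - r) ^ a * (v - u) ^ b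

/-- `F c y` is the integral of the time derivative of `W` along the characteristic
`{(r, c - r) : 0 ≤ r ≤ y}`, with quantitative bounds. -/
structure IsLineIntegral (T : ℝ) (J : Set ℝ) (a b C : ℝ) (W : ℝ × ℝ → ℝ) (F : ℝ → ℝ → ℝ) :
    Prop where
  zero : ∀ c, F c 0 = 0
  left : ∀ c, ∀ x ∈ Set.Icc 0 T, ∀ y ∈ Set.Icc 0 T, x ≤ y → c - x ∈ J → c - y ∈ J →
    |F c y - F c x - (W (y, c - x) - W (x, c - x))| ≤ C * (y - x) ^ (a + b)
  right : ∀ c, ∀ x ∈ Set.Icc 0 T, ∀ y ∈ Set.Icc 0 T, x ≤ y → c - x ∈ J → c - y ∈ J →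
    |F c y - F c x - (W (y, c - y) - W (x, c - y))| ≤ C * (y - x) ^ (a + b)
  strip : ∀ c c', c ≤ c' → c' - c ≤ T → ∀ y ∈ Set.Icc 0 T, c' ∈ J → c - y ∈ J →
    |F c' y - F c y| ≤ C * (c' - c) ^ (a + b - 1)

lemma IsLineIntegral.mono {T : ℝ} {J : Set ℝ} {a b C C' : ℝ} {W : ℝ × ℝ → ℝ} {F : ℝ → ℝ → ℝ}
    (h : IsLineIntegral T J a b C W F) (hC : C ≤ C') : IsLineIntegral T J a b C' W F where
  zero := h.zero
  left c x hx y hy hxy hx' hy' := (h.left c x hx y hy hxy hx' hy').trans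
    (mul_le_mul_of_nonneg_right hC (Real.rpow_nonneg (sub_nonneg.2 hxy) _))
  right c x hx y hy hxy hx' hy' := (h.right c x hx y hy hxy hx' hy').trans
    (mul_le_mul_of_nonneg_right hC (Real.rpow_nonneg (sub_nonneg.2 hxy) _))
  strip c c' hcc hT y hy hc' hcy := (h.strip c c' hcc hT y hy hc' hcy).trans
    (mul_le_mul_of_nonneg_right hC (Real.rpow_nonneg (sub_nonneg.2 hcc) _))

lemma abs_sub_le_of_steps {H : ℝ → ℝ} {y k D : ℝ} (hy : 0 ≤ y) (hk : 0 < k) (hD : 0 ≤ D)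
    (h : ∀ p p', 0 ≤ p → p ≤ p' → p' ≤ y → p' - p ≤ k → |H p' - H p| ≤ D) :
    |H y - H 0| ≤ (y / k + 2) * D := by
  obtain ⟨n, hn⟩ : ∃ n, n = ⌈y / k⌉₊ + 1 := ⟨_, rfl⟩
  have hn0 : (0 : ℝ) < n := by rw [hn]; positivity
  have hn1 : y / k ≤ n := by
    rw [hn]; push_cast; linarith [Nat.le_ceil (y / k)]
  have hn2 : (n : ℝ) ≤ y / k + 2 := by
    rw [hn]; push_cast; linarith [Nat.ceil_lt_add_one (div_nonneg hy hk.le)]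
  set p : ℕ → ℝ := fun i => y * (i / n) with hp
  have e0 : p 0 = 0 := by simp [hp]
  have e1 : p n = y := by simp [hp, hn0.ne']
  have hs : ∀ i, p (i + 1) - p i = y / n := fun i => by
    simp only [hp]; push_cast; field_simp; ring
  have hyn : y / n ≤ k := by
    rw [div_le_iff₀ hn0]; rw [div_le_iff₀ hk] at hn1; linarith
  have htel : H y - H 0 = ∑ i ∈ Finset.range n, (H (p (i + 1)) - H (p i)) := by
    rw [Finset.sum_range_sub (fun i => H (p i)), e0, e1]
  rw [htel]
  refine (Finset.abs_sum_le_sum_abs _ _).trans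
    ((Finset.sum_le_card_nsmul _ _ D fun i hi => ?_).trans ?_)
  · have hi' : ((i + 1 : ℕ) : ℝ) ≤ n := by exact_mod_cast Finset.mem_range.1 hi
    have hd : 0 ≤ y / n := by positivity
    refine h _ _ (by simp only [hp]; positivity) (by linarith [hs i]) ?_ (by rw [hs]; exact hyn)
    simp only [hp]
    have : ((i + 1 : ℕ) : ℝ) / n ≤ 1 := (div_le_one hn0).2 hi'
    nlinarith
  · simp only [Finset.card_range, nsmul_eq_mul]
    exact mul_le_mul_of_nonneg_right hn2 hD

/-- The defect of the germ `W(y, c - x) - W(x, c - x)` is □W over `[y,z] × [c-y,c-x]`, of order `a +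
b > 1`, so sewing applies for each `c` separately. Closeness for different `c` comes from cutting
the strip between the lines. -/
lemma exists_line_integral {T : ℝ} {J : Set ℝ} (hJ : J.OrdConnected) {a b C : ℝ}
    (ha : 0 ≤ a) (hb : 0 ≤ b) (hab : 1 < a + b) (hC : 0 ≤ C) {W : ℝ × ℝ → ℝ}
    (hW : LocalRectBound T J a b C W) :
    ∃ F C', 0 ≤ C' ∧ IsLineIntegral T J a b C' W F := by
  set κ := sewConst (a + b) with hκ
  have hκ0 : 0 < κ := sewConst_pos hab
  have hdef : ∀ c, DefectBound {u | u ∈ Set.Icc 0 T ∧ c - u ∈ J}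
      (fun x y => W (y, c - x) - W (x, c - x)) C (a + b) := by
    rintro c x ⟨hx, hx'⟩ y ⟨hy, hy'⟩ z ⟨hz, hz'⟩ hxy hyz
    have e : W (z, c - x) - W (x, c - x) - (W (y, c - x) - W (x, c - x))
        - (W (z, c - y) - W (y, c - y)) = rectIncr W y z (c - y) (c - x) := by
      unfold rectIncr; ring
    simp only
    rw [e]
    refine (hW y hy z hz hyz _ hy' _ hx' (by linarith) (by linarith [hx.1, hy.2])).trans ?_
    rw [mul_assoc]
    exact mul_le_mul_of_nonneg_left (rpow_mul_rpow_le (by linarith) (by linarith) (by linarith)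
      (by linarith) ha hb) hC
  choose F hF using fun c => sewing hab hC (hdef c)
  have hleft : ∀ c, ∀ x ∈ Set.Icc 0 T, ∀ y ∈ Set.Icc 0 T, x ≤ y → c - x ∈ J → c - y ∈ J →
      |F c y - F c x - (W (y, c - x) - W (x, c - x))| ≤ κ * C * (y - x) ^ (a + b) :=
    fun c x hx y hy hxy hx' hy' => hF c x ⟨hx, hx'⟩ y ⟨hy, hy'⟩ hxy
  have hsub : ∀ c x y : ℝ, F c y - F c 0 - (F c x - F c 0) = F c y - F c x :=
    fun c x y => by ring
  have hT3 : ∀ y ∈ Set.Icc 0 T, (0 : ℝ) ≤ T := fun y hy => hy.1.trans hy.2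
  refine ⟨fun c y => F c y - F c 0, max (κ * C + C) (3 * |T| * (C + 2 * (κ * C))), by positivity,
    fun c => sub_self _, ?_, ?_, ?_⟩
  · intro c x hx y hy hxy hx' hy'
    rw [hsub]
    refine (hleft c x hx y hy hxy hx' hy').trans (mul_le_mul_of_nonneg_right
      (le_max_of_le_left (by linarith)) (Real.rpow_nonneg (by linarith) _))
  · intro c x hx y hy hxy hx' hy'
    rw [hsub]
    have h1 := hleft c x hx y hy hxy hx' hy'
    have h2 := hW x hx y hy hxy _ hy' _ hx' (by linarith) (by linarith [hx.1, hy.2])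
    have h3 : C * (y - x) ^ a * (c - x - (c - y)) ^ b ≤ C * (y - x) ^ (a + b) := by
      rw [mul_assoc]
      exact mul_le_mul_of_nonneg_left (rpow_mul_rpow_le (by linarith) (by linarith) (by linarith)
        (by linarith) ha hb) hC
    refine le_trans ?_ (mul_le_mul_of_nonneg_right
      (le_max_left (κ * C + C) (3 * |T| * (C + 2 * (κ * C)))) (Real.rpow_nonneg (by linarith) _))
    rw [add_mul]
    have h4 := h2.trans h3
    unfold rectIncr at h4
    rw [abs_le] at *
    constructor <;> linarith [h1.1, h1.2, h4.1, h4.2]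
  · intro c c' hcc hT y hy hc' hcy
    have hT0 := hT3 y hy
    rcases hcc.eq_or_lt with rfl | hlt
    · rw [sub_self, abs_zero]
      exact mul_nonneg (by positivity) (Real.rpow_nonneg (by linarith) _)
    set k := c' - c with hk
    have hk0 : 0 < k := sub_pos.2 hlt
    have hmem : ∀ p, 0 ≤ p → p ≤ y → c - p ∈ J ∧ c' - p ∈ J := fun p hp hpy =>
      ⟨hJ.out hcy hc' ⟨by linarith, by linarith⟩, hJ.out hcy hc' ⟨by linarith, by linarith⟩⟩
    -- On a step of length at most `k` the two line integrals differ by one rectangle of `W` and two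
    -- sewing errors. The number of steps, about `y / k`, then loses one power of `k`.
    have hstep := abs_sub_le_of_steps (H := fun u => F c' u - F c u) (y := y) (k := k)
      (D := (C + 2 * (κ * C)) * k ^ (a + b)) hy.1 hk0 (by positivity) (by
        intro p p' hp hpp hpy hpk
        obtain ⟨m1, m2⟩ := hmem p hp (hpp.trans hpy)
        obtain ⟨m3, m4⟩ := hmem p' (hp.trans hpp) hpy
        have i1 : p ∈ Set.Icc 0 T := ⟨hp, by linarith [hy.2]⟩
        have i2 : p' ∈ Set.Icc 0 T := ⟨by linarith, by linarith [hy.2]⟩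
        have h1 := hleft c p i1 p' i2 hpp m1 m3
        have h2 := hleft c' p i1 p' i2 hpp m2 m4
        have h3 := hW p i1 p' i2 hpp _ m1 _ m2 (by linarith) (by linarith)
        have h4 : C * (p' - p) ^ a * (c' - p - (c - p)) ^ b ≤ C * k ^ (a + b) := by
          rw [mul_assoc]
          exact mul_le_mul_of_nonneg_left (rpow_mul_rpow_le (by linarith) (by linarith)
            (by linarith) (by linarith) ha hb) hC
        have h5 : κ * C * (p' - p) ^ (a + b) ≤ κ * C * k ^ (a + b) :=
          mul_le_mul_of_nonneg_left (Real.rpow_le_rpow (by linarith) hpk (by linarith))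
            (by positivity)
        have h6 := h3.trans h4
        have h1' := h1.trans h5
        have h2' := h2.trans h5
        rw [add_mul]
        unfold rectIncr at h6
        rw [abs_le] at *
        constructor <;> linarith [h1'.1, h1'.2, h2'.1, h2'.2, h6.1, h6.2])
    have e1 : F c' y - F c' 0 - (F c y - F c 0) = F c' y - F c y - (F c' 0 - F c 0) := by ring
    rw [e1]
    refine hstep.trans ?_
    have e2 : k ^ (a + b) = k * k ^ (a + b - 1) := by
      rw [Real.rpow_sub_one hk0.ne']; field_simp
    have h0 : 0 ≤ k ^ (a + b - 1) := Real.rpow_nonneg hk0.le _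
    have e3 : (y / k + 2) * ((C + 2 * (κ * C)) * k ^ (a + b))
        = (y + 2 * k) * (C + 2 * (κ * C)) * k ^ (a + b - 1) := by
      rw [e2]; field_simp
    rw [e3]
    refine mul_le_mul_of_nonneg_right (le_max_of_le_right ?_) h0
    refine mul_le_mul_of_nonneg_right ?_ (by positivity)
    rw [abs_of_nonneg hT0]
    linarith [hy.2]

/-- Reflection in space exchanges the two families of characteristics, so `exists_line_integral`
serves both. -/
lemma LocalRectBound.neg {T : ℝ} {J : Set ℝ} {a b C : ℝ} {W : ℝ × ℝ → ℝ}
    (hW : LocalRectBound T J a b C W) :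
    LocalRectBound T {v | -v ∈ J} a b C (fun p => W (p.1, -p.2)) := by
  intro s hs s' hs' hss t ht t' ht' htt hT
  have := hW s hs s' hs' hss (-t') ht' (-t) ht (by linarith) (by linarith)
  rw [← abs_neg] at this
  convert this using 2
  · unfold rectIncr; ring
  · ring_nf

/-! ### The cone integral, its Hölder bounds and its staircase approximation. -/

/-- The integral of the rectangle increments of `W` over the backward cone with vertex `(s, t)`,
in terms of its line integrals `P` and `M` along the two families of characteristics. -/
def coneIntegral (P M : ℝ → ℝ → ℝ) (p : ℝ × ℝ) : ℝ :=
  P (p.2 + p.1) p.1 - M (p.1 - p.2) p.1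

lemma mem_of_mem_coneDomain {T : ℝ} {J : Set ℝ} {s t v : ℝ} (h : (s, t) ∈ coneDomain T J)
    (h1 : t - s ≤ v) (h2 : v ≤ t + s) : v ∈ J := h.2 ⟨h1, h2⟩

lemma coneDomain_of_le {T : ℝ} {J : Set ℝ} {s s' t : ℝ} (h : (s', t) ∈ coneDomain T J)
    (hs : 0 ≤ s) (hss : s ≤ s') : (s, t) ∈ coneDomain T J :=
  ⟨⟨hs, hss.trans h.1.2⟩, fun _ hv =>
    mem_of_mem_coneDomain h (by linarith [hv.1]) (by linarith [hv.2])⟩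

section

variable {T : ℝ} {J : Set ℝ} {a b C C' : ℝ} {W : ℝ × ℝ → ℝ} {P M : ℝ → ℝ → ℝ}

lemma abs_coneIntegral_space_le (hP : IsLineIntegral T J a b C' W P)
    (hM : IsLineIntegral T {v | -v ∈ J} a b C' (fun p => W (p.1, -p.2)) M) {s t t' : ℝ}
    (h : (s, t) ∈ coneDomain T J) (h' : (s, t') ∈ coneDomain T J) (htt : t ≤ t')
    (hT : t' - t ≤ T) :
    |coneIntegral P M (s, t') - coneIntegral P M (s, t)|
      ≤ 2 * C' * (t' - t) ^ (a + b - 1) := by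
  have hs := h.1
  simp only at hs
  have h1 := hP.strip (t + s) (t' + s) (by linarith) (by linarith) s hs
    (mem_of_mem_coneDomain h' (by linarith [hs.1]) (by linarith [hs.1]))
    (mem_of_mem_coneDomain h (by linarith [hs.1]) (by linarith [hs.1]))
  have h2 := hM.strip (s - t') (s - t) (by linarith) (by linarith) s hs
    (show -(s - t) ∈ J from mem_of_mem_coneDomain h (by linarith [hs.1]) (by linarith [hs.1]))
    (show -(s - t' - s) ∈ J from
      mem_of_mem_coneDomain h' (by linarith [hs.1]) (by linarith [hs.1]))
  rw [show t' + s - (t + s) = t' - t by ring] at h1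
  rw [show s - t - (s - t') = t' - t by ring] at h2
  simp only [coneIntegral]
  rw [abs_le] at *
  constructor <;> linarith [h1.1, h1.2, h2.1, h2.2]

/-- Raising the vertex moves both characteristics outward by `s' - s`, which gives two strips, and
adds a tip above time `s`, comparable to one rectangle of `W`. -/
lemma abs_coneIntegral_time_le (ha : 0 ≤ a) (hb : 0 ≤ b) (hab : 1 < a + b) (hC : 0 ≤ C)
    (hC' : 0 ≤ C') (hW : LocalRectBound T J a b C W) (hP : IsLineIntegral T J a b C' W P)
    (hM : IsLineIntegral T {v | -v ∈ J} a b C' (fun p => W (p.1, -p.2)) M) {s s' t : ℝ}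
    (h : (s', t) ∈ coneDomain T J) (hs0 : 0 ≤ s) (hss : s ≤ s') :
    |coneIntegral P M (s', t) - coneIntegral P M (s, t)|
      ≤ (2 * C' + (C + 2 * C') * T) * (s' - s) ^ (a + b - 1) := by
  have hs' := h.1
  simp only at hs'
  have hs : s ∈ Set.Icc 0 T := ⟨hs0, hss.trans hs'.2⟩
  have hJ : ∀ v, t - s' ≤ v → v ≤ t + s' → v ∈ J := fun v => mem_of_mem_coneDomain h
  have h1 := hP.strip (t + s) (t + s') (by linarith) (by linarith [hs'.2]) s hs
    (hJ _ (by linarith) (by linarith)) (hJ _ (by linarith) (by linarith))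
  have h2 := hM.strip (s - t) (s' - t) (by linarith) (by linarith [hs'.2]) s hs
    (hJ _ (by linarith) (by linarith)) (hJ _ (by linarith) (by linarith))
  -- Left endpoint for `P`, right endpoint for `M`: the rectangle replacing the tip is then `[s,s']
  -- × [t,t+s'-s]`, with space side at most `T` as `hW` requires. Left endpoints for both would
  -- double that side.
  have h3 := hP.left (t + s') s hs s' hs' hss
    (hJ _ (by linarith) (by linarith)) (hJ _ (by linarith) (by linarith))
  have h4 := hM.right (s' - t) s hs s' hs' hss
    (hJ _ (by linarith) (by linarith)) (hJ _ (by linarith) (by linarith))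
  have h5 := hW s hs s' hs' hss t (hJ _ (by linarith) (by linarith)) (t + s' - s)
    (hJ _ (by linarith) (by linarith)) (by linarith) (by linarith [hs'.2])
  rw [show t + s' - (t + s) = s' - s by ring] at h1
  rw [show s' - t - (s - t) = s' - s by ring] at h2
  simp only [show -(s' - t - s') = t by ring] at h4
  rw [show t + s' - s - t = s' - s by ring] at h5
  have h6 : C * (s' - s) ^ a * (s' - s) ^ b ≤ C * (s' - s) ^ (a + b) := by
    rw [mul_assoc]
    exact mul_le_mul_of_nonneg_left (rpow_mul_rpow_le (by linarith) (by linarith) le_rfl le_rfl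
      ha hb) hC
  have h7 : (C + 2 * C') * (s' - s) ^ (a + b)
      ≤ (C + 2 * C') * (T * (s' - s) ^ (a + b - 1)) := by
    refine mul_le_mul_of_nonneg_left ?_ (by positivity)
    rw [show a + b = 1 + (a + b - 1) by ring,
      Real.rpow_add_of_nonneg (by linarith) zero_le_one (by linarith), Real.rpow_one,
      show 1 + (a + b - 1) - 1 = a + b - 1 by ring]
    exact mul_le_mul_of_nonneg_right (by linarith [hs'.2]) (Real.rpow_nonneg (by linarith) _)
  have h8 := h5.trans h6
  unfold rectIncr at h8
  simp only [coneIntegral]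
  rw [abs_le] at *
  constructor <;> linarith [h1.1, h1.2, h2.1, h2.2, h3.1, h3.2, h4.1, h4.2, h8.1, h8.2]

/-- The cone integral is the limit of the increments of `W` over staircases. -/
lemma abs_coneIntegral_sub_staircase_le (hP : IsLineIntegral T J a b C' W P)
    (hM : IsLineIntegral T {v | -v ∈ J} a b C' (fun p => W (p.1, -p.2)) M) {s t : ℝ}
    (h : (s, t) ∈ coneDomain T J) {n : ℕ} (hn : 0 < n) :
    |coneIntegral P M (s, t) - ∑ i ∈ Finset.range n,
      rectIncr W (s * (i / n)) (s * ((i + 1 : ℕ) / n)) (t - s + s * ((i + 1 : ℕ) / n))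
        (t + s - s * (i / n))| ≤ 2 * (n * (C' * (s / n) ^ (a + b))) := by
  have hs := h.1
  simp only at hs
  have hJ : ∀ v, t - s ≤ v → v ≤ t + s → v ∈ J := fun v => mem_of_mem_coneDomain h
  have h1 : Approximates (Set.Icc 0 s) (P (t + s))
      (fun x y => W (y, t + s - x) - W (x, t + s - x)) C' (a + b) := fun x hx y hy hxy =>
    hP.left (t + s) x ⟨hx.1, hx.2.trans hs.2⟩ y ⟨hy.1, hy.2.trans hs.2⟩ hxy
      (hJ _ (by linarith [hx.1, hx.2]) (by linarith [hx.1]))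
      (hJ _ (by linarith [hy.1, hy.2]) (by linarith [hy.1]))
  have h2 : Approximates (Set.Icc 0 s) (M (s - t))
      (fun x y => W (y, t - s + y) - W (x, t - s + y)) C' (a + b) := fun x hx y hy hxy => by
    have := hM.right (s - t) x ⟨hx.1, hx.2.trans hs.2⟩ y ⟨hy.1, hy.2.trans hs.2⟩ hxy
      (hJ _ (by linarith [hx.2, hx.1]) (by linarith [hx.1, hx.2]))
      (hJ _ (by linarith [hy.2, hy.1]) (by linarith [hy.1, hy.2]))
    simpa only [show -(s - t - y) = t - s + y by ring] using this
  have e1 := abs_sub_uniform_sum_le Set.ordConnected_Icc h1 ⟨le_rfl, hs.1⟩ ⟨hs.1, le_rfl⟩ hs.1 hn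
  have e2 := abs_sub_uniform_sum_le Set.ordConnected_Icc h2 ⟨le_rfl, hs.1⟩ ⟨hs.1, le_rfl⟩ hs.1 hn
  simp only [zero_add, sub_zero, hP.zero, hM.zero] at e1 e2
  have e3 : ∑ i ∈ Finset.range n, rectIncr W (s * (i / n)) (s * ((i + 1 : ℕ) / n))
        (t - s + s * ((i + 1 : ℕ) / n)) (t + s - s * (i / n))
      = ∑ i ∈ Finset.range n, (W (s * ((i + 1 : ℕ) / n), t + s - s * (i / n))
          - W (s * (i / n), t + s - s * (i / n)))
        - ∑ i ∈ Finset.range n, (W (s * ((i + 1 : ℕ) / n), t - s + s * ((i + 1 : ℕ) / n))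
          - W (s * (i / n), t - s + s * ((i + 1 : ℕ) / n))) := by
    rw [← Finset.sum_sub_distrib]
    refine Finset.sum_congr rfl fun i _ => ?_
    unfold rectIncr; ring
  rw [e3]
  simp only [coneIntegral]
  rw [abs_le] at *
  constructor <;> linarith [e1.1, e1.2, e2.1, e2.2]

end

/-! ### Dyadic Riemann sums and staircases. -/

/-- On the dyadic grid the cone with vertex `(s, t)` consists of the nodes with
`i < j < 2 * 2 ^ n - i`. -/
lemma coneKernel_node {s t : ℝ} (hs : 0 < s) {n i : ℕ} (hi : i < 2 ^ n) (j : ℕ) :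
    coneKernel s t (timeNode s n i) (spaceNode s t n j)
      = if j ∈ Finset.Ico (i + 1) (2 ^ (n + 1) - i) then 1 / 2 else 0 := by
  have hN : (0 : ℝ) < 2 ^ n := by positivity
  have hi' : (i : ℝ) ≤ 2 ^ n := by exact_mod_cast hi.le
  have hmem : timeNode s n i ∈ Set.Icc 0 s := by
    have : (i : ℝ) / 2 ^ n ≤ 1 := (div_le_one hN).2 hi'
    have : 0 ≤ (i : ℝ) / 2 ^ n := by positivity
    unfold timeNode
    constructor <;> nlinarith
  rw [coneKernel, Set.indicator_of_mem hmem, waveKernel]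
  refine if_congr ?_ rfl rfl
  have e1 : t - spaceNode s t n j = s / 2 ^ n * (2 ^ n - j) := by
    unfold spaceNode; field_simp; ring
  have e2 : s - timeNode s n i = s / 2 ^ n * (2 ^ n - i) := by
    unfold timeNode; field_simp
  have hsN : 0 < s / 2 ^ n := by positivity
  rw [e1, e2, abs_mul, abs_of_pos hsN, mul_lt_mul_iff_right₀ hsN, abs_lt, Finset.mem_Ico, pow_succ]
  constructor
  · rintro ⟨h1, h2⟩
    have h3 : (i : ℝ) < j := by linarith
    have h4 : (j : ℝ) + i < 2 ^ n * 2 := by linarith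
    have h3' : i < j := by exact_mod_cast h3
    have h4' : j + i < 2 ^ n * 2 := by exact_mod_cast h4
    omega
  · rintro ⟨h1, h2⟩
    have h3' : i < j := by omega
    have h4' : j + i < 2 ^ n * 2 := by omega
    have h3 : (i : ℝ) < j := by exact_mod_cast h3'
    have h4 : (j : ℝ) + i < 2 ^ n * 2 := by exact_mod_cast h4'
    constructor <;> linarith

lemma riemannSum_eq {X Z : ℝ × ℝ → ℝ} {s : ℝ} (hs : 0 < s) (t : ℝ) (n : ℕ) :
    riemannSum X Z s t n = ∑ i ∈ Finset.range (2 ^ n),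
      ∑ j ∈ Finset.Ico (i + 1) (2 ^ (n + 1) - i),
        1 / 2 * (Z (timeNode s n i, spaceNode s t n j) *
          rectIncr X (timeNode s n i) (timeNode s n (i + 1))
            (spaceNode s t n j) (spaceNode s t n (j + 1))) := by
  unfold riemannSum
  refine Finset.sum_congr rfl fun i hi => ?_
  have hsub : Finset.Ico (i + 1) (2 ^ (n + 1) - i) ⊆ Finset.range (2 ^ (n + 1)) := fun j hj => by
    rw [Finset.mem_Ico] at hj
    rw [Finset.mem_range]
    omega
  rw [← Finset.sum_subset hsub]
  · refine Finset.sum_congr rfl fun j hj => ?_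
    rw [coneKernel_node hs (Finset.mem_range.1 hi), if_pos hj, mul_assoc]
  · intro j _ hj
    rw [coneKernel_node hs (Finset.mem_range.1 hi), if_neg hj, zero_mul, zero_mul]

/-- Row `i` fills the space from node `i + 1` to node `2 ^ (n + 1) - i`: its left end lies on the
characteristic at the upper time, its right end at the lower time. This asymmetry is why the
staircase is matched by `right` for `M` and by `left` for `P`. -/
lemma sum_rectIncr_row (W : ℝ × ℝ → ℝ) (s t : ℝ) {n i : ℕ} (hi : i < 2 ^ n) :
    ∑ j ∈ Finset.Ico (i + 1) (2 ^ (n + 1) - i),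
        rectIncr W (timeNode s n i) (timeNode s n (i + 1))
          (spaceNode s t n j) (spaceNode s t n (j + 1))
      = rectIncr W (s * (i / (2 ^ n : ℕ))) (s * ((i + 1 : ℕ) / (2 ^ n : ℕ)))
        (t - s + s * ((i + 1 : ℕ) / (2 ^ n : ℕ))) (t + s - s * (i / (2 ^ n : ℕ))) := by
  have hN : (2 : ℝ) ^ n ≠ 0 := by positivity
  have hle : i + 1 ≤ 2 ^ (n + 1) - i := by rw [pow_succ]; omega
  have h1 : ∀ j, rectIncr W (timeNode s n i) (timeNode s n (i + 1))
      (spaceNode s t n j) (spaceNode s t n (j + 1))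
      = (W (timeNode s n (i + 1), spaceNode s t n (j + 1))
          - W (timeNode s n i, spaceNode s t n (j + 1)))
        - (W (timeNode s n (i + 1), spaceNode s t n j)
          - W (timeNode s n i, spaceNode s t n j)) := fun j => by
    unfold rectIncr; ring
  simp only [h1]
  rw [Finset.sum_Ico_sub (fun j => W (timeNode s n (i + 1), spaceNode s t n j)
          - W (timeNode s n i, spaceNode s t n j)) hle]
  have h2 : spaceNode s t n (2 ^ (n + 1) - i) = t + s - s * (i / 2 ^ n) := by
    unfold spaceNode
    rw [Nat.cast_sub (by rw [pow_succ]; omega)]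
    push_cast
    rw [pow_succ]
    field_simp
    ring
  rw [h2]
  unfold rectIncr timeNode spaceNode
  push_cast
  ring

lemma node_mem {T : ℝ} {J : Set ℝ} {s t : ℝ} (h : (s, t) ∈ coneDomain T J) {n i j : ℕ}
    (hi : i ≤ 2 ^ n) (hj : j ≤ 2 ^ (n + 1)) :
    timeNode s n i ∈ Set.Icc 0 T ∧ spaceNode s t n j ∈ J := by
  have hs := h.1
  simp only at hs
  have hN : (0 : ℝ) < 2 ^ n := by positivity
  have h1 : (i : ℝ) / 2 ^ n ≤ 1 := (div_le_one hN).2 (by exact_mod_cast hi)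
  have h2 : (j : ℝ) / 2 ^ n ≤ 2 := (div_le_iff₀ hN).2 (by
    rw [pow_succ] at hj
    have : (j : ℝ) ≤ 2 ^ n * 2 := by exact_mod_cast hj
    linarith)
  have h3 : 0 ≤ (i : ℝ) / 2 ^ n := by positivity
  have h4 : 0 ≤ (j : ℝ) / 2 ^ n := by positivity
  unfold timeNode spaceNode
  refine ⟨⟨mul_nonneg hs.1 h3, by nlinarith [hs.1, hs.2]⟩,
    mem_of_mem_coneDomain h ?_ ?_⟩ <;> nlinarith [hs.1, hs.2]

/-- At most `N` rows of `2 * N` cells of side `d = s / N`, each with an error of order `d ^ (a + b +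
η) + d ^ (a + b + η')`. -/
lemma abs_riemannSum_sub_staircase_le {T : ℝ} {J : Set ℝ} {X Z W : ℝ × ℝ → ℝ}
    {a b η η' C : ℝ} (hC : 0 ≤ C)
    (hW : ∀ s ∈ Set.Icc 0 T, ∀ s' ∈ Set.Icc 0 T, s ≤ s' → ∀ t ∈ J, ∀ t' ∈ J, t ≤ t' →
      t' - t ≤ T → |rectIncr W s s' t t' - Z (s, t) * rectIncr X s s' t t'| ≤
        C * ((s' - s) ^ (η + a) * (t' - t) ^ b + (s' - s) ^ a * (t' - t) ^ (η' + b)))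
    {s t : ℝ} (hs : 0 < s) (h : (s, t) ∈ coneDomain T J) (n : ℕ) :
    |riemannSum X Z s t n - 1 / 2 * ∑ i ∈ Finset.range (2 ^ n),
      rectIncr W (s * (i / (2 ^ n : ℕ))) (s * ((i + 1 : ℕ) / (2 ^ n : ℕ)))
        (t - s + s * ((i + 1 : ℕ) / (2 ^ n : ℕ))) (t + s - s * (i / (2 ^ n : ℕ)))| ≤
      C * s ^ (a + b + η) * ((2 ^ n : ℕ) : ℝ) ^ (-(a + b + η - 2))
        + C * s ^ (a + b + η') * ((2 ^ n : ℕ) : ℝ) ^ (-(a + b + η' - 2)) := by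
  have hsT : s ≤ T := h.1.2
  obtain ⟨N, hN⟩ : ∃ N : ℕ, N = 2 ^ n := ⟨_, rfl⟩
  have hN0 : (0 : ℝ) < N := by rw [hN]; positivity
  have hN1 : (1 : ℝ) ≤ N := by rw [hN]; exact_mod_cast Nat.one_le_two_pow
  set d : ℝ := s / N with hd
  have hd0 : 0 < d := by positivity
  have hrow : ∑ i ∈ Finset.range (2 ^ n),
      rectIncr W (s * (i / (2 ^ n : ℕ))) (s * ((i + 1 : ℕ) / (2 ^ n : ℕ)))
        (t - s + s * ((i + 1 : ℕ) / (2 ^ n : ℕ))) (t + s - s * (i / (2 ^ n : ℕ)))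
      = ∑ i ∈ Finset.range (2 ^ n), ∑ j ∈ Finset.Ico (i + 1) (2 ^ (n + 1) - i),
        rectIncr W (timeNode s n i) (timeNode s n (i + 1))
          (spaceNode s t n j) (spaceNode s t n (j + 1)) :=
    Finset.sum_congr rfl fun i hi => (sum_rectIncr_row W s t (Finset.mem_range.1 hi)).symm
  rw [hrow, riemannSum_eq hs]
  simp only [Finset.mul_sum, ← Finset.sum_sub_distrib, ← mul_sub]
  have hcell : ∀ i ∈ Finset.range (2 ^ n), ∀ j ∈ Finset.Ico (i + 1) (2 ^ (n + 1) - i),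
      |1 / 2 * (Z (timeNode s n i, spaceNode s t n j) *
          rectIncr X (timeNode s n i) (timeNode s n (i + 1))
            (spaceNode s t n j) (spaceNode s t n (j + 1)) -
        rectIncr W (timeNode s n i) (timeNode s n (i + 1))
          (spaceNode s t n j) (spaceNode s t n (j + 1)))|
      ≤ 1 / 2 * (C * (d ^ (a + b + η) + d ^ (a + b + η'))) := by
    intro i hi j hj
    rw [Finset.mem_range] at hi
    rw [Finset.mem_Ico] at hj
    obtain ⟨u1, v1⟩ := node_mem h (i := i) (j := j) (n := n) (by omega) (by omega)
    obtain ⟨u2, v2⟩ := node_mem h (i := i + 1) (j := j + 1) (n := n) (by omega) (by omega)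
    have e1 : timeNode s n (i + 1) - timeNode s n i = d := by
      unfold timeNode; rw [hd, hN]; push_cast; field_simp; ring
    have e2 : spaceNode s t n (j + 1) - spaceNode s t n j = d := by
      unfold spaceNode; rw [hd, hN]; push_cast; field_simp; ring
    have hdT : d ≤ T := (div_le_self hs.le hN1).trans hsT
    have := hW _ u1 _ u2 (by linarith) _ v1 _ v2 (by linarith) (by linarith)
    rw [e1, e2, ← Real.rpow_add hd0, ← Real.rpow_add hd0, show η + a + b = a + b + η by ring,
      show a + (η' + b) = a + b + η' by ring] at this
    rw [abs_mul, abs_sub_comm, abs_of_pos (by norm_num : (0 : ℝ) < 1 / 2)]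
    exact mul_le_mul_of_nonneg_left this (by norm_num)
  have hpos : 0 ≤ C * (d ^ (a + b + η) + d ^ (a + b + η')) := by positivity
  have hrowle : ∀ i ∈ Finset.range (2 ^ n),
      |∑ j ∈ Finset.Ico (i + 1) (2 ^ (n + 1) - i),
        1 / 2 * (Z (timeNode s n i, spaceNode s t n j) *
          rectIncr X (timeNode s n i) (timeNode s n (i + 1))
            (spaceNode s t n j) (spaceNode s t n (j + 1)) -
        rectIncr W (timeNode s n i) (timeNode s n (i + 1))
          (spaceNode s t n j) (spaceNode s t n (j + 1)))|
      ≤ N * (C * (d ^ (a + b + η) + d ^ (a + b + η'))) := by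
    intro i hi
    refine (Finset.abs_sum_le_sum_abs _ _).trans
      ((Finset.sum_le_card_nsmul _ _ _ (hcell i hi)).trans ?_)
    have hc : ((Finset.Ico (i + 1) (2 ^ (n + 1) - i)).card : ℝ) ≤ 2 * N := by
      rw [Nat.card_Ico, hN, pow_succ]
      have : 2 ^ n * 2 - i - (i + 1) ≤ 2 * 2 ^ n := by omega
      exact_mod_cast this
    rw [nsmul_eq_mul]
    calc _ ≤ 2 * N * (1 / 2 * (C * (d ^ (a + b + η) + d ^ (a + b + η')))) := by gcongr
      _ = _ := by ring
  refine (Finset.abs_sum_le_sum_abs _ _).trans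
    ((Finset.sum_le_card_nsmul _ _ _ hrowle).trans (le_of_eq ?_))
  have hpow : ∀ p : ℝ, (N : ℝ) * (N * d ^ p) = s ^ p * (N : ℝ) ^ (-(p - 2)) := fun p => by
    rw [hd, Real.div_rpow hs.le hN0.le, neg_sub, Real.rpow_sub hN0, Real.rpow_two]
    field_simp
  rw [Finset.card_range, nsmul_eq_mul, ← hN]
  calc _ = C * (N * (N * d ^ (a + b + η))) + C * (N * (N * d ^ (a + b + η'))) := by ring
    _ = _ := by rw [hpow, hpow]; ring

lemma riemannSum_zero (X Z : ℝ × ℝ → ℝ) (t : ℝ) (n : ℕ) : riemannSum X Z 0 t n = 0 := by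
  unfold riemannSum rectIncr timeNode spaceNode
  simp

/-! ### From separate Hölder bounds to the class C^{η,η'}. -/

/-- A cone integral whose increments are Hölder continuous of order `η + η'` in time and in space
belongs to `C^{η, η'}`. -/
lemma rectHolder_of_holder {T : ℝ} (hT : 0 < T) {J : Set ℝ} {η η' K : ℝ} (hη : 0 < η)
    (hη' : 0 < η') (hK : 0 ≤ K) {E : ℝ × ℝ → ℝ}
    (hspace : ∀ s t t', (s, t) ∈ coneDomain T J → (s, t') ∈ coneDomain T J → t ≤ t' →
      t' - t ≤ T → |E (s, t') - E (s, t)| ≤ K * (t' - t) ^ (η + η'))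
    (htime : ∀ s s' t, (s', t) ∈ coneDomain T J → 0 ≤ s → s ≤ s' →
      |E (s', t) - E (s, t)| ≤ K * (s' - s) ^ (η + η')) :
    RectHolder (coneDomain T J) η η' E := by
  have hε : 0 < η + η' := by linarith
  have hspace' : ∀ s t t', (s, t) ∈ coneDomain T J → (s, t') ∈ coneDomain T J →
      |t' - t| ≤ T → |E (s, t') - E (s, t)| ≤ K * |t' - t| ^ (η + η') := by
    intro s t t' h h' hT
    rcases le_total t t' with htt | htt
    · rw [abs_of_nonneg (sub_nonneg.2 htt)] at hT ⊢
      exact hspace s t t' h h' htt hT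
    · rw [abs_sub_comm t' t, abs_of_nonneg (sub_nonneg.2 htt)] at hT ⊢
      rw [abs_sub_comm]
      exact hspace s t' t h' h htt hT
  constructor
  · rintro ⟨s, t⟩ h
    have hs := h.1
    simp only at hs
    rw [ContinuousWithinAt, tendsto_iff_norm_sub_tendsto_zero]
    have hg : Tendsto (fun p : ℝ × ℝ => K * |p.2 - t| ^ (η + η') + K * |p.1 - s| ^ (η + η'))
        (𝓝[coneDomain T J] (s, t)) (𝓝 0) := by
      have hc : Continuous fun p : ℝ × ℝ =>
          K * |p.2 - t| ^ (η + η') + K * |p.1 - s| ^ (η + η') :=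
        (continuous_const.mul ((continuous_snd.sub continuous_const).abs.rpow_const
          fun _ => Or.inr hε.le)).add
        (continuous_const.mul ((continuous_fst.sub continuous_const).abs.rpow_const
          fun _ => Or.inr hε.le))
      have := (hc.tendsto (s, t)).mono_left (nhdsWithin_le_nhds (s := coneDomain T J))
      simpa [Real.zero_rpow hε.ne'] using this
    have hnear : ∀ᶠ p : ℝ × ℝ in 𝓝[coneDomain T J] (s, t), |p.2 - t| < T := by
      refine nhdsWithin_le_nhds ?_
      have hc : Continuous fun p : ℝ × ℝ => |p.2 - t| := by fun_prop
      exact hc.continuousAt.eventually_lt continuousAt_const (by simpa using hT)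
    refine squeeze_zero' (Eventually.of_forall fun _ => norm_nonneg _) ?_ hg
    filter_upwards [hnear, self_mem_nhdsWithin] with ⟨s', t'⟩ hlt h'
    have hs' := h'.1
    simp only at hs' hlt ⊢
    rw [Real.norm_eq_abs]
    -- Move in space at the smaller of the two times: lowering the time shrinks the base of the
    -- cone, so the intermediate point stays in the domain.
    rcases le_total s s' with hss | hss
    · have h1 := htime s s' t' h' hs.1 hss
      have h2 := hspace' s t t' h (coneDomain_of_le h' hs.1 hss) hlt.le
      rw [abs_of_nonneg (sub_nonneg.2 hss)]
      rw [abs_le] at *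
      constructor <;> linarith [h1.1, h1.2, h2.1, h2.2]
    · have h1 := htime s' s t h hs'.1 hss
      have h2 := hspace' s' t t' (coneDomain_of_le h hs'.1 hss) h' hlt.le
      rw [abs_sub_comm s' s, abs_of_nonneg (sub_nonneg.2 hss)]
      rw [abs_le] at *
      constructor <;> linarith [h1.1, h1.2, h2.1, h2.2]
  · refine ⟨2 * K, fun s s' t t' hss htt hD => ?_⟩
    have m : ∀ u v, u ∈ Set.Icc s s' → v ∈ Set.Icc t t' → (u, v) ∈ coneDomain T J :=
      fun u v hu hv => hD ⟨hu, hv⟩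
    have m1 := m s t ⟨le_rfl, hss.le⟩ ⟨le_rfl, htt.le⟩
    have m2 := m s t' ⟨le_rfl, hss.le⟩ ⟨htt.le, le_rfl⟩
    have m3 := m s' t ⟨hss.le, le_rfl⟩ ⟨le_rfl, htt.le⟩
    have m4 := m s' t' ⟨hss.le, le_rfl⟩ ⟨htt.le, le_rfl⟩
    have hs0 : 0 ≤ s := m1.1.1
    have hsT : s' ≤ T := m3.1.2
    have hδ : 0 < s' - s := sub_pos.2 hss
    have hτ : 0 < t' - t := sub_pos.2 htt
    -- Take differences along the shorter side. When that side is `t' - t`, it is at most `s' - s ≤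
    -- T`, as `hspace` demands.
    rcases le_or_gt (t' - t) (s' - s) with hle | hlt
    · have h1 := hspace s t t' m1 m2 htt.le (by linarith)
      have h2 := hspace s' t t' m3 m4 htt.le (by linarith)
      have h3 : K * (t' - t) ^ (η + η') ≤ K * ((s' - s) ^ η * (t' - t) ^ η') := by
        rw [Real.rpow_add hτ]; gcongr
      have k1 := h1.trans h3
      have k2 := h2.trans h3
      rw [mul_assoc]
      unfold rectIncr
      rw [abs_le] at *
      constructor <;> linarith [k1.1, k1.2, k2.1, k2.2]
    · have h1 := htime s s' t m3 hs0 hss.le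
      have h2 := htime s s' t' m4 hs0 hss.le
      have h3 : K * (s' - s) ^ (η + η') ≤ K * ((s' - s) ^ η * (t' - t) ^ η') := by
        rw [Real.rpow_add hδ]; gcongr
      have k1 := h1.trans h3
      have k2 := h2.trans h3
      rw [mul_assoc]
      unfold rectIncr
      rw [abs_le] at *
      constructor <;> linarith [k1.1, k1.2, k2.1, k2.2]

/-! ### Using `(H_α)`, and the Young integral on rectangles of bounded width. -/

/-- Under `(H_α)` with `η ≤ α`, the function `Z` is `η`-Hölder continuous in time. -/
lemma HypH.exists_holder {T : ℝ} (hT : 0 ≤ T) {J : Set ℝ} {α η : ℝ} {Z : ℝ × ℝ → ℝ}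
    (h : HypH T J α Z) (hη : η ≤ α) (hη0 : 0 < η) :
    ∃ B, 0 ≤ B ∧ ∀ s ∈ Set.Icc 0 T, ∀ s' ∈ Set.Icc 0 T, s ≤ s' → ∀ t ∈ J,
      |Z (s', t) - Z (s, t)| ≤ B * (s' - s) ^ η := by
  obtain ⟨-, -, K, hK⟩ := h
  refine ⟨|K| * T ^ (α - η), by positivity, fun s hs s' hs' hss t ht => ?_⟩
  have h1 := hK s' hs' s hs t ht
  have hd : 0 ≤ s' - s := sub_nonneg.2 hss
  rw [abs_of_nonneg hd] at h1
  refine h1.trans ?_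
  have h2 : (s' - s) ^ α = (s' - s) ^ (α - η) * (s' - s) ^ η := by
    rw [← Real.rpow_add_of_nonneg hd (by linarith) hη0.le, sub_add_cancel]
  have h3 : (s' - s) ^ (α - η) ≤ T ^ (α - η) :=
    Real.rpow_le_rpow hd (by linarith [hs.1, hs'.2]) (by linarith)
  have h4 : 0 ≤ (s' - s) ^ η := Real.rpow_nonneg hd _
  have h5 : 0 ≤ (s' - s) ^ (α - η) := Real.rpow_nonneg hd _
  rw [h2, mul_assoc]
  exact mul_le_mul (le_abs_self K) (mul_le_mul_of_nonneg_right h3 h4) (by positivity)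
    (abs_nonneg K)

/-- The two-parameter Young integral on rectangles whose space side is at most `T`. -/
lemma exists_local_rect_integral {T : ℝ} (hT : 0 ≤ T) {J : Set ℝ} (hJ : J.OrdConnected)
    {a b η η' A B B' M : ℝ} (ha : 0 ≤ a) (hb : 0 ≤ b) (hη : 0 ≤ η) (hη' : 0 ≤ η')
    (haη : 1 < η + a) (hbη : 1 < η' + b) (hA : 0 ≤ A) (hB : 0 ≤ B) (hB' : 0 ≤ B')
    {X Z : ℝ × ℝ → ℝ} (hX : RectBound T J a b A X)
    (hZ : RectBound T J η η' B Z) (hZ0 : ∀ t ∈ J, Z (0, t) = 0)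
    (hZt : ∀ s ∈ Set.Icc 0 T, ∀ s' ∈ Set.Icc 0 T, s ≤ s' → ∀ t ∈ J,
      |Z (s', t) - Z (s, t)| ≤ B' * (s' - s) ^ η)
    (hM : ∀ s ∈ Set.Icc 0 T, ∀ t ∈ J, |Z (s, t)| ≤ M) :
    ∃ (W : ℝ × ℝ → ℝ) (C D : ℝ), 0 ≤ C ∧ 0 ≤ D ∧ LocalRectBound T J a b D W ∧
      ∀ s ∈ Set.Icc 0 T, ∀ s' ∈ Set.Icc 0 T, s ≤ s' → ∀ t ∈ J, ∀ t' ∈ J, t ≤ t' → t' - t ≤ T →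
        |rectIncr W s s' t t' - Z (s, t) * rectIncr X s s' t t'| ≤
          C * ((s' - s) ^ (η + a) * (t' - t) ^ b + (s' - s) ^ a * (t' - t) ^ (η' + b)) := by
  obtain ⟨W, C₁, C₂, C₃, h₁, h₂, h₃, hW⟩ :=
    exists_rect_integral hT hJ ha hb hη hη' haη hbη hA hB hB' hX hZ hZ0 hZt
  -- Powers above `a` or `b` are absorbed into constants only on sides of length at most `T`; `J`
  -- may be unbounded, hence the restriction on the space side.
  have hpow : ∀ k p q : ℝ, 0 ≤ k → k ≤ T → 0 ≤ p → 0 ≤ q → k ^ (p + q) ≤ T ^ p * k ^ q := by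
    intro k p q hk hkT hp hq
    rw [Real.rpow_add_of_nonneg hk hp hq]
    exact mul_le_mul_of_nonneg_right (Real.rpow_le_rpow hk hkT hp) (Real.rpow_nonneg hk _)
  set C := C₁ + C₂ * T ^ η' + C₃ with hC
  have hC0 : 0 ≤ C := by positivity
  have hloc : ∀ s ∈ Set.Icc 0 T, ∀ s' ∈ Set.Icc 0 T, s ≤ s' → ∀ t ∈ J, ∀ t' ∈ J, t ≤ t' →
      t' - t ≤ T → |rectIncr W s s' t t' - Z (s, t) * rectIncr X s s' t t'| ≤
        C * ((s' - s) ^ (η + a) * (t' - t) ^ b + (s' - s) ^ a * (t' - t) ^ (η' + b)) := by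
    intro s hs s' hs' hss t ht t' ht' htt hk
    refine (hW s hs s' hs' hss t ht t' ht' htt).trans ?_
    have hδ := sub_nonneg.2 hss
    have hτ := sub_nonneg.2 htt
    have p1 := Real.rpow_nonneg hδ (η + a)
    have p2 := Real.rpow_nonneg hδ a
    have p3 := Real.rpow_nonneg hτ b
    have p4 := Real.rpow_nonneg hτ (η' + b)
    have q := hpow _ _ _ hτ hk hη' hb
    calc _ ≤ (C₁ * (t' - t) ^ b + C₂ * (T ^ η' * (t' - t) ^ b)) * (s' - s) ^ (η + a)
            + C₃ * (s' - s) ^ a * (t' - t) ^ (η' + b) := by gcongr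
      _ = (C₁ + C₂ * T ^ η') * ((s' - s) ^ (η + a) * (t' - t) ^ b)
            + C₃ * ((s' - s) ^ a * (t' - t) ^ (η' + b)) := by ring
      _ ≤ C * ((s' - s) ^ (η + a) * (t' - t) ^ b)
            + C * ((s' - s) ^ a * (t' - t) ^ (η' + b)) := by
          have e1 : C₁ + C₂ * T ^ η' ≤ C := by rw [hC]; linarith
          have e2 : C₃ ≤ C := by rw [hC]; linarith [mul_nonneg h₂ (Real.rpow_nonneg hT η')]
          gcongr
      _ = _ := by ring
  refine ⟨W, C, C * (T ^ η + T ^ η') + |M| * A, hC0, by positivity, ?_, hloc⟩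
  intro s hs s' hs' hss t ht t' ht' htt hk
  have hδ := sub_nonneg.2 hss
  have hτ := sub_nonneg.2 htt
  have p2 := Real.rpow_nonneg hδ a
  have p3 := Real.rpow_nonneg hτ b
  have q1 := hpow _ _ _ hδ (by linarith [hs.1, hs'.2]) hη ha
  have q2 := hpow _ _ _ hτ hk hη' hb
  have h1 := hloc s hs s' hs' hss t ht t' ht' htt hk
  have h2 : |Z (s, t) * rectIncr X s s' t t'| ≤ |M| * (A * (s' - s) ^ a * (t' - t) ^ b) := by
    rw [abs_mul]
    exact mul_le_mul ((hM s hs t ht).trans (le_abs_self M)) (hX s hs s' hs' hss t ht t' ht' htt)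
      (abs_nonneg _) (abs_nonneg _)
  have h3 : C * ((s' - s) ^ (η + a) * (t' - t) ^ b + (s' - s) ^ a * (t' - t) ^ (η' + b))
      ≤ C * ((T ^ η * (s' - s) ^ a) * (t' - t) ^ b + (s' - s) ^ a * (T ^ η' * (t' - t) ^ b)) := by
    gcongr
  have h4 := h1.trans h3
  have h5 := abs_sub_abs_le_abs_sub (rectIncr W s s' t t') (Z (s, t) * rectIncr X s s' t t')
  refine le_trans (by linarith : _ ≤ C * ((T ^ η * (s' - s) ^ a) * (t' - t) ^ b
    + (s' - s) ^ a * (T ^ η' * (t' - t) ^ b)) + |M| * (A * (s' - s) ^ a * (t' - t) ^ b))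
    (le_of_eq (by ring))

end YoungWave

/-! ### Assembly. -/

theorem proposition4p3 (T : ℝ) (hT : 0 < T) (J : Set ℝ) (hJ : J.OrdConnected)
    (γ γ' ρ : ℝ) (hγ : γ ∈ Set.Ioo (0 : ℝ) 1) (hγ' : γ' ∈ Set.Ioo (0 : ℝ) 1)
    (hsum : 5 / 3 < γ + γ')
    (hρ : ρ ∈ Set.Ioo ((3 - 2 * γ - γ') / γ') ((2 * γ' + γ - 2) / γ'))
    (X Z : ℝ × ℝ → ℝ)
    (hX : YoungWave.RectHolder (Set.Icc 0 T ×ˢ J) γ γ' X)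
    (hZ : YoungWave.RectHolder (Set.Icc 0 T ×ˢ J) (ρ * γ' + γ - 1) ((1 - ρ) * γ') Z)
    (hH : ∀ α ∈ Set.Ioo (2 * (2 - γ - γ')) 1, YoungWave.HypH T J α Z) :
    ∃ I : ℝ × ℝ → ℝ,
      (∀ p ∈ YoungWave.coneDomain T J, YoungWave.IsYoungIntegral X Z p.1 p.2 (I p)) ∧
      YoungWave.RectHolder (YoungWave.coneDomain T J)
        (ρ * γ' + γ - 1) ((1 - ρ) * γ') I := by
  obtain ⟨ha0, ha1⟩ := hγ
  obtain ⟨hb0, hb1⟩ := hγ'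
  obtain ⟨hρ1, hρ2⟩ := hρ
  rw [div_lt_iff₀ hb0] at hρ1
  rw [lt_div_iff₀ hb0] at hρ2
  obtain ⟨η, hηdef⟩ : ∃ η, η = ρ * γ' + γ - 1 := ⟨_, rfl⟩
  obtain ⟨η', hη'def⟩ : ∃ η', η' = (1 - ρ) * γ' := ⟨_, rfl⟩
  have hη'eq : η' = γ' - ρ * γ' := by rw [hη'def]; ring
  rw [← hηdef, ← hη'def] at hZ ⊢
  -- The lower bound on `ρ` reads `η > 2 - γ - γ'`, the upper one `η' > 2 - γ - γ'`. Positivity, `η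
  -- + γ > 1`, `η' + γ' > 1` and the convergence rates below all follow.
  have hη : 0 < η := by linarith
  have hη' : 0 < η' := by linarith
  have hηη : η + η' = γ + γ' - 1 := by linarith
  -- An admissible `α` above `η`, so that `Z` is `η`-Hölder in time.
  obtain ⟨α, hα1, hα2⟩ := exists_between (show max (2 * (2 - γ - γ')) η < 1 from
    max_lt (by linarith) (by linarith))
  have hα := hH α ⟨(le_max_left _ _).trans_lt hα1, hα2⟩
  obtain ⟨B', hB', hZt⟩ := hα.exists_holder hT.le ((le_max_right _ _).trans hα1.le) hη
  obtain ⟨⟨M, hM⟩, hZ0, -⟩ := hα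
  obtain ⟨A, hA, hX'⟩ := hX.exists_rectBound hJ
  obtain ⟨B, hB, hZ'⟩ := hZ.exists_rectBound hJ
  obtain ⟨W, C, D, hC, hD, hWD, hW⟩ := YoungWave.exists_local_rect_integral hT.le hJ ha0.le hb0.le
    hη.le hη'.le (by linarith) (by linarith) hA hB hB' hX' hZ' hZ0 hZt hM
  have hJ' : {v | -v ∈ J}.OrdConnected := ⟨fun x hx y hy z hz =>
    hJ.out hy hx ⟨neg_le_neg hz.2, neg_le_neg hz.1⟩⟩
  have hab : 1 < γ + γ' := by linarith
  obtain ⟨P, C₁, hC₁, hP⟩ := YoungWave.exists_line_integral hJ ha0.le hb0.le hab hD hWD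
  obtain ⟨Q, C₂, hC₂, hQ⟩ := YoungWave.exists_line_integral hJ' ha0.le hb0.le hab hD hWD.neg
  obtain ⟨C', hC'def⟩ : ∃ C', C' = max C₁ C₂ := ⟨_, rfl⟩
  have hC' : 0 ≤ C' := by rw [hC'def]; exact hC₁.trans (le_max_left _ _)
  replace hP := hP.mono (hC'def ▸ le_max_left C₁ C₂)
  replace hQ := hQ.mono (hC'def ▸ le_max_right C₁ C₂)
  refine ⟨fun p => 1 / 2 * YoungWave.coneIntegral P Q p, ?_, ?_⟩
  · rintro ⟨s, t⟩ h
    have hs := h.1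
    simp only at hs ⊢
    unfold YoungWave.IsYoungIntegral
    rcases hs.1.eq_or_lt with rfl | hs0
    · have : YoungWave.coneIntegral P Q (0, t) = 0 := by
        simp [YoungWave.coneIntegral, hP.zero, hQ.zero]
      rw [this, mul_zero]
      simp only [funext (YoungWave.riemannSum_zero X Z t)]
      exact tendsto_const_nhds
    · rw [tendsto_iff_norm_sub_tendsto_zero]
      have hpow : Tendsto (fun n : ℕ => 2 ^ n) atTop (atTop : Filter ℕ) :=
        tendsto_pow_atTop_atTop_of_one_lt one_lt_two
      have l1 := (YoungWave.tendsto_natCast_rpow_neg (κ := γ + γ' + η - 2) (by linarith)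
        (C * s ^ (γ + γ' + η))).comp hpow
      have l2 := (YoungWave.tendsto_natCast_rpow_neg (κ := γ + γ' + η' - 2) (by linarith)
        (C * s ^ (γ + γ' + η'))).comp hpow
      have l3 := (YoungWave.tendsto_natCast_rpow_neg (κ := γ + γ' - 1) (by linarith)
        (C' * s ^ (γ + γ'))).comp hpow
      have l := (l1.add l2).add l3
      simp only [add_zero] at l
      refine squeeze_zero (fun _ => norm_nonneg _) (fun n => ?_) l
      rw [Real.norm_eq_abs]
      have e1 := YoungWave.abs_riemannSum_sub_staircase_le hC hW hs0 h n
      have e2 := YoungWave.abs_coneIntegral_sub_staircase_le hP hQ h (n := 2 ^ n) (by positivity)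
      rw [YoungWave.mul_div_rpow_eq hs.1 (by positivity)] at e2
      simp only [Function.comp_apply]
      rw [abs_le] at *
      constructor <;> linarith [e1.1, e1.2, e2.1, e2.2]
  · refine YoungWave.rectHolder_of_holder hT hη hη' (K := C' + (D + 2 * C') * T) (by positivity)
      ?_ ?_
    · intro s t t' h h' htt hk
      have := YoungWave.abs_coneIntegral_space_le hP hQ h h' htt hk
      rw [← hηη] at this
      rw [← mul_sub, abs_mul, abs_of_pos (by norm_num : (0 : ℝ) < 1 / 2)]
      have h0 := Real.rpow_nonneg (sub_nonneg.2 htt) (η + η')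
      have h1 : 0 ≤ (D + 2 * C') * T * (t' - t) ^ (η + η') := by positivity
      linarith
    · intro s s' t h hs0 hss
      have := YoungWave.abs_coneIntegral_time_le ha0.le hb0.le hab hD hC' hWD hP hQ h hs0 hss
      rw [← hηη] at this
      rw [← mul_sub, abs_mul, abs_of_pos (by norm_num : (0 : ℝ) < 1 / 2)]
      have h0 := Real.rpow_nonneg (sub_nonneg.2 hss) (η + η')
      have h1 : 0 ≤ (D + 2 * C') * T * (s' - s) ^ (η + η') := by positivity
      linarith
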